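/- **Setting.** A finite-dimensional $C^*$-pre-bialgebra is a finite-dimensional unital associative algebra $\mathcal A$ over $\mathbb C$ with * a linear coproduct $\Delta:\mathcal A\to\mathcal A\otimes\mathcal A$ satisfying $(\Delta\otimes\mathrm{id})\Delta=(\mathrm{id}\otimes\Delta)\Delta$ and $\Delta(xy)=\Delta(x)\Delta(y)$ (neither a counit nor $\Delta(1)=1\otimes1$ is assumed), and * an antilinear involution $*$ with $(xy)^*=y^*x^*$ and $\Delta(x^*)=\Delta(x)^{*\otimes *}$, such that $\mathcal A$ has a faithful finite-dimensional $*$-representation. The dual $\mathcal A^*$ is an associative algebra with product $(fg)(x)=(f\otimes g)(\Delta(x))$. It may lack a unit and need not be semisimple. Let $\{\phi_a\}_{a\in\mathrm{Irr}(\mathcal A)}$ be a system of representatives of the equivalence classes of irreducible representations of $\mathcal A$, each chosen to be a (unital) $*$-representation $\phi_a:\mathcal A\to M_{D_a}(\mathbb C)$. Let $N_{ab}^c=\dim\mathrm{Hom}(\phi_c,\phi_a\boxtimes\phi_b)$ be the multiplicity of $\phi_c$ in $\phi_a\boxtimes\phi_b:=(\phi_a\otimes\phi_b)\circ\Delta$,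 and let $N_a$ be the matrix with entries $(N_a)_{cb}=N_{ab}^c$. Let $d_a$ be the spectral radius of $N_a$, and $\mathrm{FPdim}:=\sum_a d_a^2$. A tensor $M=(M^{ij}_{\alpha\beta})$ with physical indices $i,j$ and bond indices $\alpha,\beta$ is regarded as a family of physical operators $M_{\alpha\beta}=(M^{ij}_{\alpha\beta})_{ij}$, or as a family of bond matrices $M^{ij}=(M^{ij}_{\alpha\beta})_{\alpha\beta}$. It *satisfies the renormalization fixed point conditions* if there are quantum channels (completely positive trace-preserving linear maps) $\mathcal T$, from operators on one physical site to operators on two sites, and $\mathcal S$, from two sites to one, with $$\mathcal T(M_{\alpha\beta})=\sum_\gamma M_{\alpha\gamma}\otimes M_{\gamma\beta},\qquad \mathcal S\Big(\sum_\gamma M_{\alpha\gamma}\otimes M_{\gamma\beta}\Big)=M_{\alpha\beta}\qquad\text{for all }\alpha,\beta.$$ It *generates a matrix product density operator (MPDO)* if, for every $N\ge1$, the operator $$\rho^{(N)}(M)=\sum_{\{i,j\}}\mathrm{Tr}\big(M^{i_1j_1}\cdots M^{i_Nj_N}\big)\,|i_1\cdots i_N\rangle\langle j_1\cdots j_N|$$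 is Hermitian and positive semidefinite. It is a *renormalization fixed point of MPDOs* if it generates an MPDO and satisfies the renormalization fixed point conditions. **Theorem.** Let $\mathcal A$ be a finite-dimensional semisimple $C^*$-pre-bialgebra. Suppose that 1. the multiplicities are transitive: for all $a,b\in\mathrm{Irr}(\mathcal A)$ there are $c,d\in\mathrm{Irr}(\mathcal A)$ with $N_{ac}^d>0$ and $N_{da}^b>0$; 2. for every $a\in\mathrm{Irr}(\mathcal A)$ there is $a^*\in\mathrm{Irr}(\mathcal A)$ with $N_{a^*}=N_a^{T}$. Let $\psi$ be a faithful finite-dimensional matrix representation of $\mathcal A^*$, let $\{e_I\}$ be a basis of $\mathcal A$ with dual basis $\{e^I\}$, and let $$M=\bigoplus_{a\in\mathrm{Irr}(\mathcal A)}\frac{d_a}{\mathrm{FPdim}}\,\tilde A_a,\qquad (\tilde A_a)^{ij}_{\alpha\beta}=\sum_I[\phi_a(e_I)]_{ij}\,[\psi(e^I)]_{\alpha\beta},$$ where the direct sum is over the physical space. Then $M$ satisfies the renormalization fixed point conditions. If, in addition, $\sum_I\mathrm{Tr}[\psi(e^I)]\,e_I=yy^*$ for some $y\in\mathcal A$,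 then $M$ generates an MPDO, and so $M$ is a renormalization fixed point of MPDOs. -/

import Mathlib

open scoped TensorProduct Matrix Kronecker ComplexOrder

noncomputable section

/-- A `C^*`-pre-bialgebra structure on a unital complex `*`-algebra `A`: a coassociative,
multiplicative coproduct (not assumed unital, and with no counit) that commutes with the
involution, such that `A` has a faithful `*`-representation by matrices. -/
structure CStarPreBialgebra (A : Type*) [Ring A] [Algebra ℂ A] [StarRing A] [StarModule ℂ A] where
  /-- the coproduct -/
  comul : A →ₗ[ℂ] A ⊗[ℂ] A
  coassoc : (TensorProduct.assoc ℂ A A A).toLinearMap ∘ₗ comul.rTensor A ∘ₗ comul =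
    comul.lTensor A ∘ₗ comul
  comul_mul : ∀ x y : A, comul (x * y) = comul x * comul y
  comul_star : ∀ x : A, comul (star x) = star (comul x)
  exists_faithful : ∃ (n : ℕ) (π : A →⋆ₐ[ℂ] Matrix (Fin n) (Fin n) ℂ), Function.Injective π

/-- A matrix representation is irreducible: the space is non-zero and has no
invariant subspace other than `0` and itself. -/
def IsIrrRep {A : Type*} [Ring A] [Algebra ℂ A] {n : ℕ}
    (π : A →ₐ[ℂ] Matrix (Fin n) (Fin n) ℂ) : Prop :=
  0 < n ∧ ∀ W : Submodule ℂ (Fin n → ℂ), (∀ (x : A), ∀ v ∈ W, π x *ᵥ v ∈ W) → W = ⊥ ∨ W = ⊤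

/-- Equivalence (isomorphism) of matrix representations. -/
def RepEquiv {A : Type*} [Ring A] [Algebra ℂ A] {m n : ℕ}
    (π : A →ₐ[ℂ] Matrix (Fin m) (Fin m) ℂ) (π' : A →ₐ[ℂ] Matrix (Fin n) (Fin n) ℂ) : Prop :=
  ∃ e : (Fin m → ℂ) ≃ₗ[ℂ] (Fin n → ℂ), ∀ (x : A) (v : Fin m → ℂ), e (π x *ᵥ v) = π' x *ᵥ e v

/-- `φ a`, `a : ι`, is a system of representatives of `Irr(A)`: irreducible
`*`-representations, pairwise inequivalent, and every irreducible representation of `A` is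
equivalent to one of them. -/
structure IsIrrSystem {A : Type*} [Ring A] [Algebra ℂ A] [StarRing A] [StarModule ℂ A]
    {ι : Type*} (D : ι → ℕ) (φ : ∀ a, A →⋆ₐ[ℂ] Matrix (Fin (D a)) (Fin (D a)) ℂ) : Prop where
  irreducible : ∀ a, IsIrrRep (φ a).toAlgHom
  inequivalent : ∀ a b, RepEquiv (φ a).toAlgHom (φ b).toAlgHom → a = b
  complete : ∀ (n : ℕ) (π : A →ₐ[ℂ] Matrix (Fin n) (Fin n) ℂ), IsIrrRep π →
    ∃ a, RepEquiv (φ a).toAlgHom π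

namespace CStarPreBialgebra

variable {A : Type*} [Ring A] [Algebra ℂ A] [StarRing A] [StarModule ℂ A]

/-- The product of the dual `A^*`, the transpose of the coproduct:
`(f g)(x) = (f ⊗ g)(Δ x)`. -/
def dualMul (B : CStarPreBialgebra A) (f g : Module.Dual ℂ A) : Module.Dual ℂ A :=
  LinearMap.mul' ℂ ℂ ∘ₗ TensorProduct.map f g ∘ₗ B.comul

/-- `ψ` is a faithful matrix representation of the (not necessarily unital) algebra `A^*`. -/
def IsFaithfulDualRep (B : CStarPreBialgebra A) {χ : Type*} [Fintype χ]
    (ψ : Module.Dual ℂ A →ₗ[ℂ] Matrix χ χ ℂ) : Prop :=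
  (∀ f g, ψ (B.dualMul f g) = ψ f * ψ g) ∧ Function.Injective ψ

/-- The tensor product representation `φ ⊠ φ' = (φ ⊗ φ') ∘ Δ`. -/
def tensorRep (B : CStarPreBialgebra A) {m n : ℕ} (φ : A →⋆ₐ[ℂ] Matrix (Fin m) (Fin m) ℂ)
    (φ' : A →⋆ₐ[ℂ] Matrix (Fin n) (Fin n) ℂ) :
    A →ₗ[ℂ] Matrix (Fin m × Fin n) (Fin m × Fin n) ℂ :=
  TensorProduct.lift ((Matrix.kroneckerBilinear (R := ℂ) (α := ℂ) :
    Matrix (Fin m) (Fin m) ℂ →ₗ[ℂ] Matrix (Fin n) (Fin n) ℂ →ₗ[ℂ]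
      Matrix (Fin m × Fin n) (Fin m × Fin n) ℂ).compl₁₂
    φ.toAlgHom.toLinearMap φ'.toAlgHom.toLinearMap) ∘ₗ B.comul

/-- The space `Hom(φ'', φ ⊠ φ')` of intertwiners. -/
def intertwiners (B : CStarPreBialgebra A) {m n k : ℕ}
    (φ : A →⋆ₐ[ℂ] Matrix (Fin m) (Fin m) ℂ) (φ' : A →⋆ₐ[ℂ] Matrix (Fin n) (Fin n) ℂ)
    (φ'' : A →⋆ₐ[ℂ] Matrix (Fin k) (Fin k) ℂ) :
    Submodule ℂ (Matrix (Fin m × Fin n) (Fin k) ℂ) where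
  carrier := {T | ∀ x : A, B.tensorRep φ φ' x * T = T * φ'' x}
  add_mem' := fun hS hT x => by rw [Matrix.mul_add, Matrix.add_mul, hS x, hT x]
  zero_mem' := fun x => by rw [Matrix.mul_zero, Matrix.zero_mul]
  smul_mem' := fun c T hT x => by rw [Matrix.mul_smul, Matrix.smul_mul, hT x]

variable {ι : Type*} {D : ι → ℕ}

/-- The fusion multiplicity `N_{ab}^c`: the multiplicity of the irreducible representation
`φ_c` in `φ_a ⊠ φ_b`, as the dimension of `Hom(φ_c, φ_a ⊠ φ_b)`. -/
def fusionMult (B : CStarPreBialgebra A)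
    (φ : ∀ a, A →⋆ₐ[ℂ] Matrix (Fin (D a)) (Fin (D a)) ℂ) (a b c : ι) : ℕ :=
  Module.finrank ℂ (B.intertwiners (φ a) (φ b) (φ c))

/-- The matrix `N_a` with entries `(N_a)_{cb} = N_{ab}^c`. -/
def fusionMatrix (B : CStarPreBialgebra A)
    (φ : ∀ a, A →⋆ₐ[ℂ] Matrix (Fin (D a)) (Fin (D a)) ℂ) (a : ι) : Matrix ι ι ℕ :=
  Matrix.of fun c b => B.fusionMult φ a b c

/-- Transitivity of the fusion multiplicities. -/
def IsTransitive (B : CStarPreBialgebra A)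
    (φ : ∀ a, A →⋆ₐ[ℂ] Matrix (Fin (D a)) (Fin (D a)) ℂ) : Prop :=
  ∀ a b : ι, ∃ c d : ι, 0 < B.fusionMult φ a c d ∧ 0 < B.fusionMult φ d a b

variable [Fintype ι] [DecidableEq ι]

/-- `d_a`, the spectral radius of `N_a`. -/
def fpDim (B : CStarPreBialgebra A)
    (φ : ∀ a, A →⋆ₐ[ℂ] Matrix (Fin (D a)) (Fin (D a)) ℂ) (a : ι) : ℝ :=
  (spectralRadius ℂ ((B.fusionMatrix φ a).map (fun n : ℕ => (n : ℂ)))).toReal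

/-- `FPdim = ∑_a d_a²`. -/
def totalFPDim (B : CStarPreBialgebra A)
    (φ : ∀ a, A →⋆ₐ[ℂ] Matrix (Fin (D a)) (Fin (D a)) ℂ) : ℝ :=
  ∑ a, B.fpDim φ a ^ 2

end CStarPreBialgebra

/-- An MPO tensor with virtual (bond) index set `χ` and physical index set `σ`:
`M α β` is the matrix with entries `M^{ij}_{αβ}`. -/
abbrev MPOTensor (χ σ : Type*) := χ → χ → Matrix σ σ ℂ

namespace MPOTensor

variable {χ σ : Type*} [Fintype χ] [DecidableEq χ] [Fintype σ] [DecidableEq σ]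

/-- The bond matrix `M^{ij}`. -/
def bondMatrix (M : MPOTensor χ σ) (i j : σ) : Matrix χ χ ℂ :=
  Matrix.of fun α β => M α β i j

/-- The operator `ρ^{(N)}(M)`, with entries `Tr(M^{i_1 j_1} ⋯ M^{i_N j_N})`. -/
def mpo (M : MPOTensor χ σ) (N : ℕ) : Matrix (Fin N → σ) (Fin N → σ) ℂ :=
  Matrix.of fun i j => (List.ofFn fun k => M.bondMatrix (i k) (j k)).prod.trace

/-- `M` generates a matrix product density operator: `ρ^{(N)}` is Hermitian and positive
semidefinite for every system size `N ≥ 1`. -/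
def GeneratesMPDO (M : MPOTensor χ σ) : Prop :=
  ∀ N : ℕ, 1 ≤ N → (M.mpo N).PosSemidef

/-- The concatenation of two copies of `M`:
the two-site tensor `∑_γ M_{αγ} ⊗ M_{γβ}`. -/
def concat (M : MPOTensor χ σ) : MPOTensor χ (σ × σ) :=
  fun α β => ∑ γ, M α γ ⊗ₖ M γ β

end MPOTensor

/-- `T` is a quantum channel: completely positive and trace preserving. -/
def IsQuantumChannel {m n : Type*} [Fintype m] [Fintype n]
    (T : Matrix m m ℂ →ₗ[ℂ] Matrix n n ℂ) : Prop :=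
  (∀ (k : ℕ) (X : Matrix (Fin k × m) (Fin k × m) ℂ), X.PosSemidef →
    (Matrix.of fun p q : Fin k × n =>
      T (Matrix.of fun i j => X (p.1, i) (q.1, j)) p.2 q.2).PosSemidef) ∧
  ∀ X, (T X).trace = X.trace

namespace MPOTensor

variable {χ σ : Type*} [Fintype χ] [DecidableEq χ] [Fintype σ] [DecidableEq σ]

/-- The renormalization fixed point conditions: quantum channels on the physical space map one
copy of the tensor to two concatenated copies and back, for all values of the bond indices. -/
def RFPConditions (M : MPOTensor χ σ) : Prop :=
  ∃ (T : Matrix σ σ ℂ →ₗ[ℂ] Matrix (σ × σ) (σ × σ) ℂ)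
    (S : Matrix (σ × σ) (σ × σ) ℂ →ₗ[ℂ] Matrix σ σ ℂ),
    IsQuantumChannel T ∧ IsQuantumChannel S ∧
    ∀ α β, T (M α β) = M.concat α β ∧ S (M.concat α β) = M α β

end MPOTensor

namespace CStarPreBialgebra

variable {A : Type*} [Ring A] [Algebra ℂ A] [StarRing A] [StarModule ℂ A]
  {χ κ : Type*} [Fintype χ] [DecidableEq χ] [Fintype κ]

/-- The MPO tensor built from a representation `φ` of `A` and a representation `ψ` of `A^*`:
`∑_I [φ(e_I)]_{ij} [ψ(e^I)]_{αβ}`. -/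
def repTensor (e : Module.Basis κ ℂ A) {n : ℕ} (φ : A →⋆ₐ[ℂ] Matrix (Fin n) (Fin n) ℂ)
    (ψ : Module.Dual ℂ A →ₗ[ℂ] Matrix χ χ ℂ) : MPOTensor χ (Fin n) :=
  fun α β => ∑ I, ψ (e.coord I) α β • φ (e I)

/-- The tensor `⨁_a (d_a / FPdim) Ã_a`, the direct sum being over the physical space. -/
def fixedPointTensor (B : CStarPreBialgebra A) {ι : Type*} [Fintype ι] [DecidableEq ι]
    {D : ι → ℕ} (φ : ∀ a, A →⋆ₐ[ℂ] Matrix (Fin (D a)) (Fin (D a)) ℂ)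
    (e : Module.Basis κ ℂ A) (ψ : Module.Dual ℂ A →ₗ[ℂ] Matrix χ χ ℂ) :
    MPOTensor χ (Σ a, Fin (D a)) :=
  fun α β => Matrix.blockDiagonal' fun a =>
    ((B.fpDim φ a / B.totalFPDim φ : ℝ) : ℂ) • repTensor e (φ a) ψ α β

/-- The element `x = ∑_I Tr[ψ(e^I)] e_I` of `A` selected by periodic boundary conditions. -/
def boundaryElement (e : Module.Basis κ ℂ A) (ψ : Module.Dual ℂ A →ₗ[ℂ] Matrix χ χ ℂ) : A :=
  ∑ I, (ψ (e.coord I)).trace • e I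

end CStarPreBialgebra

end

/-! Semisimplicity makes `A` the direct sum of its matrix blocks, so every tracial functional, in
particular the character of φ_a ⊠ φ_b, is a combination of the irreducible characters χ_c, here with
coefficients N_{ab}^c. Coassociativity makes χ_a χ_b = ∑ N_{ab}^c χ_c an associative product, in
which N_a is left multiplication by χ_a (`fusionMult_assoc`). Transitivity makes right
multiplication by ∑ χ_b a matrix with positive entries. It commutes with every N_a, so its Perron
vector is a common eigenvector, the eigenvalues are the d_a, and ∑_e N_{ab}^e d_e = d_a d_b. The
hypothesis N_{a*} = N_aᵀ transposes this to ∑_b N_{ab}^c d_b = d_a d_c. Hence w_a = d_a / FPdim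
satisfies ∑_{a,b} N_{ab}^c w_a w_b = w_c.

Since ψ is multiplicative, contracting a bond is the coproduct on the physical side: for the same x
in `A`, one site carries ⨁ w_c φ_c(x) and two sites carry ⨁ w_a w_b (φ_a ⊠ φ_b)(x). The channel T
embeds block c through φ_a ⊠ φ_b with weight w_a w_b / w_c, and S is the trace adjoint of the
unweighted embedding, completed off the supports of the possibly non-unital φ_a ⊠ φ_b. The equation
for w makes T trace preserving and S its inverse on these operators (`exists_channels`).

For the MPDO property, ρ^(N) is the image of the boundary element under a `*`-multiplicative map,
conjugated by the diagonal matrix of square roots of the weights; an element y y^* gives a positive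
operator. -/

noncomputable section

/-! ### Joint faithfulness and density of the irreducible representations -/

section Structure

variable {A : Type*} [Ring A] [Algebra ℂ A]

/-- The `A`-module underlying a matrix representation of `A`. -/
def RepModule {n : ℕ} (_π : A →ₐ[ℂ] Matrix (Fin n) (Fin n) ℂ) : Type := Fin n → ℂ

namespace RepModule

variable {n : ℕ} (π : A →ₐ[ℂ] Matrix (Fin n) (Fin n) ℂ)

instance : AddCommGroup (RepModule π) := inferInstanceAs (AddCommGroup (Fin n → ℂ))

instance : Module ℂ (RepModule π) := inferInstanceAs (Module ℂ (Fin n → ℂ))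

instance : FiniteDimensional ℂ (RepModule π) :=
  inferInstanceAs (FiniteDimensional ℂ (Fin n → ℂ))

instance : Module A (RepModule π) where
  smul x v := π x *ᵥ (v : Fin n → ℂ)
  one_smul v := (congrArg (fun X => X *ᵥ (v : Fin n → ℂ)) (map_one π)).trans (Matrix.one_mulVec _)
  mul_smul x y v := (congrArg (fun X => X *ᵥ (v : Fin n → ℂ)) (map_mul π x y)).trans
    (Matrix.mulVec_mulVec _ _ _).symm
  smul_zero x := Matrix.mulVec_zero (π x)
  smul_add x v w := Matrix.mulVec_add (π x) v w
  add_smul x y v := (congrArg (fun X => X *ᵥ (v : Fin n → ℂ)) (map_add π x y)).trans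
    (Matrix.add_mulVec _ _ _)
  zero_smul v := (congrArg (fun X => X *ᵥ (v : Fin n → ℂ)) (map_zero π)).trans
    (Matrix.zero_mulVec _)

instance : IsScalarTower ℂ A (RepModule π) where
  smul_assoc c x v := (congrArg (fun X => X *ᵥ (v : Fin n → ℂ)) (map_smul π c x)).trans
    (Matrix.smul_mulVec _ _ _)

variable {π}

theorem isSimpleModule (h : IsIrrRep π) : IsSimpleModule A (RepModule π) := by
  have : NeZero n := ⟨h.1.ne'⟩
  have : Nontrivial (RepModule π) := inferInstanceAs (Nontrivial (Fin n → ℂ))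
  refine { eq_bot_or_eq_top := fun W => ?_ }
  rcases h.2 (W.restrictScalars ℂ) (fun x v hv => W.smul_mem x hv) with h | h
  · left
    ext v
    exact (SetLike.ext_iff.mp h v)
  · right
    ext v
    exact (SetLike.ext_iff.mp h v)

end RepModule

/-- A simple module of finite dimension is given by an irreducible matrix representation. -/
theorem exists_irrRep_of_isSimpleModule (V : Type*) [AddCommGroup V] [Module ℂ V] [Module A V]
    [IsScalarTower ℂ A V] [FiniteDimensional ℂ V] [IsSimpleModule A V] :
    ∃ (n : ℕ) (π : A →ₐ[ℂ] Matrix (Fin n) (Fin n) ℂ), IsIrrRep π ∧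
      ∀ x : A, π x = 0 → ∀ v : V, x • v = 0 := by
  let b := Module.finBasis ℂ V
  let π : A →ₐ[ℂ] Matrix (Fin (Module.finrank ℂ V)) (Fin (Module.finrank ℂ V)) ℂ :=
    (LinearMap.toMatrixAlgEquiv b).toAlgHom.comp (Algebra.lsmul ℂ ℂ V)
  have hπ : ∀ (x : A) (v : V), π x *ᵥ b.equivFun v = b.equivFun (x • v) := fun x v => by
    exact LinearMap.toMatrix_mulVec_repr b b (Algebra.lsmul ℂ ℂ V x) v
  have := IsSimpleModule.nontrivial A V
  refine ⟨_, π, ⟨Module.finrank_pos, fun W hW => ?_⟩, fun x hx v => ?_⟩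
  · let W' : Submodule A V :=
      { W.comap b.equivFun.toLinearMap with
        smul_mem' := fun x v hv => by
          have := hW x _ hv
          change b.equivFun (x • v) ∈ W
          rw [← hπ]
          exact this }
    have hmem : ∀ w, w ∈ W ↔ b.equivFun.symm w ∈ W' := fun w => by
      change _ ↔ b.equivFun (b.equivFun.symm w) ∈ W
      rw [LinearEquiv.apply_symm_apply]
    rcases eq_bot_or_eq_top W' with h | h
    · left
      ext w
      rw [hmem, h, Submodule.mem_bot, Submodule.mem_bot, LinearEquiv.map_eq_zero_iff]
    · right
      ext w
      rw [hmem, h]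
      simp
  · apply b.equivFun.injective
    rw [← hπ, hx, Matrix.zero_mulVec, map_zero]

variable [StarRing A] [StarModule ℂ A] {ι : Type*} {D : ι → ℕ}
  {φ : ∀ a, A →⋆ₐ[ℂ] Matrix (Fin (D a)) (Fin (D a)) ℂ}

/-- The irreducible representations of a semisimple algebra are jointly faithful. -/
theorem IsIrrSystem.eq_zero [FiniteDimensional ℂ A] [IsSemisimpleRing A] (hφ : IsIrrSystem D φ)
    {x : A} (hx : ∀ a, φ a x = 0) : x = 0 := by
  -- For a maximal left ideal `I` the module `A ⧸ I` is simple, so `x` kills the class of 1 and lies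
  -- in `I`. The intersection of all such `I` is zero.
  have hJ : Ring.jacobson A = ⊥ := IsSemisimpleRing.jacobson_eq_bot A
  rw [← Ideal.mem_bot, ← hJ, Ring.jacobson_eq_sInf_isMaximal, Ideal.mem_sInf]
  intro I hI
  have : I.IsMaximal := hI
  have : IsSimpleModule A (A ⧸ I) := isSimpleModule_iff_isCoatom.mpr ‹I.IsMaximal›.out
  obtain ⟨n, π, hπ, h0⟩ := exists_irrRep_of_isSimpleModule (A := A) (A ⧸ I)
  obtain ⟨a, e, he⟩ := hφ.complete n π hπ
  have hx0 : π x = 0 := by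
    refine Matrix.toLin'.injective (LinearMap.ext fun v => ?_)
    obtain ⟨w, rfl⟩ := e.surjective v
    have := he x w
    rw [Matrix.toLin'_apply, ← this]
    change e (φ a x *ᵥ w) = _
    rw [hx a]
    simp
  have := h0 x hx0 (Submodule.Quotient.mk 1)
  rw [← Submodule.Quotient.mk_smul, Submodule.Quotient.mk_eq_zero, smul_eq_mul, mul_one] at this
  exact this

theorem IsIrrSystem.ext [FiniteDimensional ℂ A] [IsSemisimpleRing A] (hφ : IsIrrSystem D φ)
    {x y : A} (h : ∀ a, φ a x = φ a y) : x = y :=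
  sub_eq_zero.mp <| hφ.eq_zero fun a => by rw [map_sub, h a, sub_self]

/-- The irreducible representations of a semisimple algebra are jointly surjective. -/
theorem IsIrrSystem.exists_preimage [Fintype ι] [DecidableEq ι] [IsSemisimpleRing A]
    (hφ : IsIrrSystem D φ) (X : ∀ a, Matrix (Fin (D a)) (Fin (D a)) ℂ) :
    ∃ x : A, ∀ a, φ a x = X a := by
  let V : ι → Type := fun a => RepModule (φ a).toAlgHom
  have : ∀ a, IsSimpleModule A (V a) := fun a => RepModule.isSimpleModule (hφ.irreducible a)
  let act : ∀ a, V a →ₗ[ℂ] V a := fun a => (X a).mulVecLin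
  -- Schur's lemma: the component `V b → V a` of `g` is a scalar if `a = b` and zero otherwise. So
  -- the action of `X` commutes with the commutant of `A`, as the density theorem requires.
  have hg : ∀ (g : Module.End A (∀ a, V a)) (a b : ι) (v : V b),
      g (Pi.single b (act b v)) a = act a (g (Pi.single b v) a) := by
    intro g a b v
    let gab : V b →ₗ[A] V a := LinearMap.proj a ∘ₗ g ∘ₗ LinearMap.single A V b
    change gab (act b v) = act a (gab v)
    by_cases hab : b = a
    · subst hab
      obtain ⟨c, hc⟩ := (IsSimpleModule.algebraMap_end_bijective_of_isAlgClosed (A := A)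
        (V := V b) ℂ).2 gab
      have hc' : ∀ w, gab w = c • w := fun w => by rw [← hc]; rfl
      rw [hc', hc', map_smul]
    · have : gab = 0 := by
        by_contra hne
        have hbij := LinearMap.bijective_of_ne_zero hne
        exact hab (hφ.inequivalent b a
          ⟨LinearEquiv.ofBijective (gab.restrictScalars ℂ) hbij, fun x w => gab.map_smul x w⟩)
      rw [this, LinearMap.zero_apply, LinearMap.zero_apply, map_zero]
  let f : Module.End (Module.End A (∀ a, V a)) (∀ a, V a) :=
    { toFun := fun m a => act a (m a)
      map_add' := fun m m' => by ext1 a; exact map_add _ _ _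
      map_smul' := fun g m => by
        ext1 a
        change act a (g m a) = g (fun b => act b (m b)) a
        have h1 : m = ∑ b, Pi.single b (m b) := (Finset.univ_sum_single m).symm
        have h2 : (fun b => act b (m b)) = ∑ b, Pi.single b (act b (m b)) :=
          (Finset.univ_sum_single _).symm
        rw [h2]
        conv_lhs => rw [h1]
        simp only [map_sum, Finset.sum_apply, hg] }
  -- The standard basis vectors of all blocks: agreement on these finitely many vectors fixes every
  -- matrix.
  let u : (Σ a, Fin (D a)) → ∀ a, V a :=
    fun s => Pi.single s.1 (Pi.single s.2 1 : Fin (D s.1) → ℂ)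
  classical
  obtain ⟨x, hx⟩ := jacobson_density f (Finset.univ.image u)
  refine ⟨x, fun a => ?_⟩
  ext i j
  have h := congrFun (hx (u ⟨a, j⟩) (Finset.mem_image_of_mem _ (Finset.mem_univ _))) a
  have hu : u ⟨a, j⟩ a = (Pi.single j 1 : Fin (D a) → ℂ) := Pi.single_eq_same _ _
  have h' : X a *ᵥ (Pi.single j 1 : Fin (D a) → ℂ) = φ a x *ᵥ Pi.single j 1 := by
    have h1 : act a (u ⟨a, j⟩ a) = x • (u ⟨a, j⟩ a) := h
    rw [hu] at h1
    exact h1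
  have := congrFun h' i
  simpa using this.symm

theorem IsIrrSystem.dim_pos (hφ : IsIrrSystem D φ) (a : ι) : 0 < D a := (hφ.irreducible a).1

end Structure

/-! ### Matrix units and tracial functionals -/

namespace IsIrrSystem

variable {A : Type*} [Ring A] [Algebra ℂ A] [StarRing A] [StarModule ℂ A]
  [IsSemisimpleRing A] {ι : Type*} [Fintype ι] [DecidableEq ι] {D : ι → ℕ}
  {φ : ∀ a, A →⋆ₐ[ℂ] Matrix (Fin (D a)) (Fin (D a)) ℂ} (hφ : IsIrrSystem D φ)

/-- The matrix unit `e_{ij}` of the block `c`, as an element of `A`. -/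
def matrixUnit (c : ι) (i j : Fin (D c)) : A :=
  (hφ.exists_preimage (Pi.single c (Matrix.single i j 1))).choose

/-- A distinguished index of the block `c`. -/
def base (c : ι) : Fin (D c) := ⟨0, hφ.dim_pos c⟩

theorem map_matrixUnit (a c : ι) (i j : Fin (D c)) :
    φ a (hφ.matrixUnit c i j) =
      (Pi.single c (Matrix.single i j 1) : ∀ a, Matrix (Fin (D a)) (Fin (D a)) ℂ) a :=
  (hφ.exists_preimage (Pi.single c (Matrix.single i j 1))).choose_spec a

theorem map_matrixUnit_same (c : ι) (i j : Fin (D c)) :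
    φ c (hφ.matrixUnit c i j) = Matrix.single i j 1 := by
  rw [map_matrixUnit, Pi.single_eq_same]

theorem map_matrixUnit_of_ne {a c : ι} (h : a ≠ c) (i j : Fin (D c)) :
    φ a (hφ.matrixUnit c i j) = 0 := by
  rw [map_matrixUnit, Pi.single_eq_of_ne h]

variable [FiniteDimensional ℂ A]

theorem eq_sum_matrixUnit (x : A) :
    x = ∑ c, ∑ i, ∑ j, φ c x i j • hφ.matrixUnit c i j := by
  refine hφ.ext fun a => ?_
  simp only [map_sum, map_smul]
  rw [Finset.sum_eq_single a]
  · simp only [map_matrixUnit_same]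
    conv_lhs => rw [Matrix.matrix_eq_sum_single (φ a x)]
    simp
  · intro c _ hc
    simp [map_matrixUnit_of_ne hφ hc.symm]
  · simp

theorem mul_matrixUnit (x : A) (c : ι) (i j : Fin (D c)) :
    x * hφ.matrixUnit c i j = ∑ k, φ c x k i • hφ.matrixUnit c k j := by
  refine hφ.ext fun a => ?_
  simp only [map_sum, map_smul, map_mul]
  by_cases h : a = c
  · subst h
    simp only [map_matrixUnit_same]
    ext p q
    simp [Matrix.sum_apply, Matrix.mul_apply, Matrix.single_apply, ite_and]
  · simp [map_matrixUnit_of_ne hφ h]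

theorem matrixUnit_mul_matrixUnit (c : ι) (i j k : Fin (D c)) :
    hφ.matrixUnit c i j * hφ.matrixUnit c j k = hφ.matrixUnit c i k := by
  rw [mul_matrixUnit, map_matrixUnit_same]
  simp [Matrix.single_apply]

theorem matrixUnit_mul_matrixUnit_of_ne (c : ι) {i j k l : Fin (D c)} (h : j ≠ k) :
    hφ.matrixUnit c i j * hφ.matrixUnit c k l = 0 := by
  rw [mul_matrixUnit, map_matrixUnit_same]
  simp [h]

theorem star_matrixUnit (c : ι) (i j : Fin (D c)) :
    star (hφ.matrixUnit c i j) = hφ.matrixUnit c j i := by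
  refine hφ.ext fun a => ?_
  rw [map_star]
  by_cases h : a = c
  · subst h
    simp [map_matrixUnit_same, Matrix.star_eq_conjTranspose]
  · simp [map_matrixUnit_of_ne hφ h]

/-- A tracial functional on `A` is a combination of the irreducible characters. -/
theorem tracial_eq_sum (f : A →ₗ[ℂ] ℂ) (hf : ∀ x y, f (x * y) = f (y * x)) (x : A) :
    f x = ∑ c, f (hφ.matrixUnit c (hφ.base c) (hφ.base c)) * (φ c x).trace := by
  obtain ⟨t, ht⟩ : ∃ t : ι → ℂ, ∀ c, f (hφ.matrixUnit c (hφ.base c) (hφ.base c)) = t c :=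
    ⟨_, fun _ => rfl⟩
  -- With o the base index, e_{ij} = e_{io} e_{oj}, while the reversed product e_{oj} e_{io} is
  -- e_{oo} or 0.
  have h : ∀ c i j, f (hφ.matrixUnit c i j) = if i = j then t c else 0 := by
    intro c i j
    rw [← hφ.matrixUnit_mul_matrixUnit c i (hφ.base c) j, hf]
    split_ifs with hij
    · subst hij
      rw [matrixUnit_mul_matrixUnit, ht]
    · rw [matrixUnit_mul_matrixUnit_of_ne _ _ (Ne.symm hij), map_zero]
  simp only [ht]
  conv_lhs => rw [hφ.eq_sum_matrixUnit x]
  simp only [map_sum, map_smul, h, smul_eq_mul, Matrix.trace, Matrix.diag, Finset.mul_sum]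
  refine Finset.sum_congr rfl fun c _ => Finset.sum_congr rfl fun i _ => ?_
  simp [mul_comm]

end IsIrrSystem

/-- A multiplicative linear map into matrices that commutes with the involution. -/
structure IsStarMul {A : Type*} [Ring A] [Algebra ℂ A] [StarRing A] {n : Type*} [Fintype n]
    (F : A →ₗ[ℂ] Matrix n n ℂ) : Prop where
  map_mul : ∀ x y, F (x * y) = F x * F y
  map_star : ∀ x, F (star x) = (F x)ᴴ

/-! ### Tensor products of matrix-valued maps -/

section TensorMap

variable {A : Type*} [Ring A] [Algebra ℂ A] {m n : Type*}

/-- `F ⊗ G` on `A ⊗ A`. -/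
def kroneckerMap (F : A →ₗ[ℂ] Matrix m m ℂ) (G : A →ₗ[ℂ] Matrix n n ℂ) :
    A ⊗[ℂ] A →ₗ[ℂ] Matrix (m × n) (m × n) ℂ :=
  TensorProduct.lift ((Matrix.kroneckerBilinear (R := ℂ) (α := ℂ) :
    Matrix m m ℂ →ₗ[ℂ] Matrix n n ℂ →ₗ[ℂ] Matrix (m × n) (m × n) ℂ).compl₁₂ F G)

/-- The matrix entry of a linear map into matrices, as a functional. -/
def matrixEntry (F : A →ₗ[ℂ] Matrix m m ℂ) (i j : m) : Module.Dual ℂ A :=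
  Matrix.entryLinearMap ℂ ℂ i j ∘ₗ F

variable (F : A →ₗ[ℂ] Matrix m m ℂ) (G : A →ₗ[ℂ] Matrix n n ℂ)

@[simp]
theorem matrixEntry_apply (i j : m) (x : A) : matrixEntry F i j x = F x i j := rfl

@[simp]
theorem kroneckerMap_tmul (x y : A) : kroneckerMap F G (x ⊗ₜ y) = F x ⊗ₖ G y := rfl

/-- Entries of F ⊗ G are tensor products of functionals; after composition with the coproduct they
become products in the dual algebra. -/
theorem kroneckerMap_apply (t : A ⊗[ℂ] A) (i j : m) (k l : n) :
    kroneckerMap F G t (i, k) (j, l) =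
      LinearMap.mul' ℂ ℂ (TensorProduct.map (matrixEntry F i j) (matrixEntry G k l) t) := by
  induction t with
  | zero => simp
  | tmul x y => simp
  | add t u ht hu => simp only [map_add, Matrix.add_apply, ht, hu]

theorem trace_kroneckerMap [Fintype m] [Fintype n] (t : A ⊗[ℂ] A) :
    (kroneckerMap F G t).trace = LinearMap.mul' ℂ ℂ (TensorProduct.map
      (Matrix.traceLinearMap m ℂ ℂ ∘ₗ F) (Matrix.traceLinearMap n ℂ ℂ ∘ₗ G) t) := by
  induction t with
  | zero => simp
  | tmul x y => simp [Matrix.trace_kronecker]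
  | add t u ht hu => simp only [map_add, Matrix.trace_add, ht, hu]

variable {F G}

theorem kroneckerMap_mul [Fintype m] [Fintype n] (hF : ∀ x y, F (x * y) = F x * F y)
    (hG : ∀ x y, G (x * y) = G x * G y) (t u : A ⊗[ℂ] A) :
    kroneckerMap F G (t * u) = kroneckerMap F G t * kroneckerMap F G u := by
  induction t with
  | zero => simp
  | add t t' ht ht' => simp only [add_mul, map_add, ht, ht']
  | tmul x y =>
    induction u with
    | zero => simp
    | add u u' hu hu' => simp only [mul_add, map_add, hu, hu']
    | tmul x' y' => simp [Algebra.TensorProduct.tmul_mul_tmul, hF, hG, Matrix.mul_kronecker_mul]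

variable [StarRing A] [StarModule ℂ A]

theorem kroneckerMap_star (hF : ∀ x, F (star x) = (F x)ᴴ)
    (hG : ∀ x, G (star x) = (G x)ᴴ) (t : A ⊗[ℂ] A) :
    kroneckerMap F G (star t) = (kroneckerMap F G t)ᴴ := by
  induction t with
  | zero => simp
  | add t t' ht ht' => simp only [star_add, map_add, ht, ht', Matrix.conjTranspose_add]
  | tmul x y => simp [TensorProduct.star_tmul, hF, hG, Matrix.conjTranspose_kronecker]

/-- Unitality would not survive here, as Δ(1) need not be 1 ⊗ 1; hence `IsStarMul` does not ask for
it. -/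
theorem IsStarMul.conv [Fintype m] [Fintype n] (hF : IsStarMul F) (hG : IsStarMul G)
    (B : CStarPreBialgebra A) : IsStarMul (kroneckerMap F G ∘ₗ B.comul) where
  map_mul x y := by
    simp only [LinearMap.comp_apply, B.comul_mul, kroneckerMap_mul hF.map_mul hG.map_mul]
  map_star x := by
    simp only [LinearMap.comp_apply, B.comul_star, kroneckerMap_star hF.map_star hG.map_star]

omit [StarModule ℂ A] in
theorem isStarMul_starAlgHom {k : ℕ} (f : A →⋆ₐ[ℂ] Matrix (Fin k) (Fin k) ℂ) :
    IsStarMul f.toAlgHom.toLinearMap where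
  map_mul x y := _root_.map_mul f x y
  map_star x := StarHomClass.map_star f x

end TensorMap

/-! ### The dual algebra, characters and fusion multiplicities -/

namespace CStarPreBialgebra

variable {A : Type*} [Ring A] [Algebra ℂ A] [StarRing A] [StarModule ℂ A]
  (B : CStarPreBialgebra A)

theorem dualMul_apply (f g : Module.Dual ℂ A) (x : A) :
    B.dualMul f g x = LinearMap.mul' ℂ ℂ (TensorProduct.map f g (B.comul x)) := rfl

/-- Both sides are f ⊗ g ⊗ h, realised as `m₃`, applied to the two iterated coproducts, which
coassociativity identifies. -/
theorem dualMul_assoc (f g h : Module.Dual ℂ A) :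
    B.dualMul (B.dualMul f g) h = B.dualMul f (B.dualMul g h) := by
  let m₃ : A ⊗[ℂ] (A ⊗[ℂ] A) →ₗ[ℂ] ℂ :=
    LinearMap.mul' ℂ ℂ ∘ₗ TensorProduct.map f (LinearMap.mul' ℂ ℂ ∘ₗ TensorProduct.map g h)
  have h1 : LinearMap.mul' ℂ ℂ ∘ₗ TensorProduct.map (B.dualMul f g) h =
      m₃ ∘ₗ (TensorProduct.assoc ℂ A A A).toLinearMap ∘ₗ B.comul.rTensor A := by
    refine TensorProduct.ext' fun x y => ?_
    have : ∀ t : A ⊗[ℂ] A, LinearMap.mul' ℂ ℂ (TensorProduct.map f g t) * h y =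
        m₃ (TensorProduct.assoc ℂ A A A (t ⊗ₜ y)) := by
      intro t
      induction t with
      | zero => simp
      | tmul p q => simp [m₃, mul_assoc]
      | add t u ht hu => simp only [map_add, add_mul, TensorProduct.add_tmul, ht, hu]
    exact this (B.comul x)
  have h2 : LinearMap.mul' ℂ ℂ ∘ₗ TensorProduct.map f (B.dualMul g h) =
      m₃ ∘ₗ B.comul.lTensor A := by
    refine TensorProduct.ext' fun x y => ?_
    simp [m₃, dualMul_apply]
  have := congrArg (fun L => m₃ ∘ₗ L) B.coassoc
  simp only [← LinearMap.comp_assoc] at this h1 h2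
  rw [← h1, ← h2] at this
  exact this

/-- The product of `A^*` as a bilinear map. -/
def dualMulBilin : Module.Dual ℂ A →ₗ[ℂ] Module.Dual ℂ A →ₗ[ℂ] Module.Dual ℂ A :=
  LinearMap.mk₂ ℂ B.dualMul
    (fun f f' g => by ext x; simp [dualMul_apply, TensorProduct.map_add_left])
    (fun c f g => by ext x; simp [dualMul_apply, TensorProduct.map_smul_left])
    (fun f g g' => by ext x; simp [dualMul_apply, TensorProduct.map_add_right])
    (fun c f g => by ext x; simp [dualMul_apply, TensorProduct.map_smul_right])

theorem dualMul_eq (f g : Module.Dual ℂ A) : B.dualMul f g = B.dualMulBilin f g := rfl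

theorem dualMul_sum_left {κ : Type*} (s : Finset κ) (c : κ → ℂ) (f : κ → Module.Dual ℂ A)
    (g : Module.Dual ℂ A) :
    B.dualMul (∑ k ∈ s, c k • f k) g = ∑ k ∈ s, c k • B.dualMul (f k) g := by
  simp only [dualMul_eq, map_sum, map_smul, LinearMap.sum_apply, LinearMap.smul_apply]

theorem dualMul_sum_right {κ : Type*} (s : Finset κ) (c : κ → ℂ) (f : κ → Module.Dual ℂ A)
    (g : Module.Dual ℂ A) :
    B.dualMul g (∑ k ∈ s, c k • f k) = ∑ k ∈ s, c k • B.dualMul g (f k) := by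
  simp only [dualMul_eq, map_sum, map_smul]

variable {ι : Type*} {D : ι → ℕ} (φ : ∀ a, A →⋆ₐ[ℂ] Matrix (Fin (D a)) (Fin (D a)) ℂ)

/-- The linear map underlying `φ a`. -/
abbrev irrLin (a : ι) : A →ₗ[ℂ] Matrix (Fin (D a)) (Fin (D a)) ℂ := (φ a).toAlgHom.toLinearMap

theorem isStarMul_tensorRep (a b : ι) : IsStarMul (B.tensorRep (φ a) (φ b)) :=
  (isStarMul_starAlgHom (φ a)).conv (isStarMul_starAlgHom (φ b)) B

/-- The character of `φ a`, an element of `A^*`. -/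
def irrChar (a : ι) : Module.Dual ℂ A := Matrix.traceLinearMap _ ℂ ℂ ∘ₗ irrLin φ a

omit [StarModule ℂ A] in
@[simp]
theorem irrChar_apply (a : ι) (x : A) : irrChar φ a x = (φ a x).trace := rfl

theorem trace_tensorRep (a b : ι) (x : A) :
    (B.tensorRep (φ a) (φ b) x).trace = B.dualMul (irrChar φ a) (irrChar φ b) x :=
  trace_kroneckerMap _ _ _

variable {φ} [Fintype ι] [DecidableEq ι] [FiniteDimensional ℂ A] [IsSemisimpleRing A]
  (hφ : IsIrrSystem D φ)
include hφ

/-- Intertwiners from `φ c` correspond to vectors in the range of a minimal projection of the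
block `c`. -/
theorem fusionMult_eq_finrank (a b c : ι) :
    B.fusionMult φ a b c = Module.finrank ℂ (LinearMap.range
      (B.tensorRep (φ a) (φ b) (hφ.matrixUnit c (hφ.base c) (hφ.base c))).toLin') := by
  set π := B.tensorRep (φ a) (φ b) with hπ
  have hmul : ∀ x y, π (x * y) = π x * π y := (B.isStarMul_tensorRep φ a b).map_mul
  set o := hφ.base c
  have hmem : ∀ v : Fin (D a) × Fin (D b) → ℂ,
      v ∈ LinearMap.range (π (hφ.matrixUnit c o o)).toLin' ↔ π (hφ.matrixUnit c o o) *ᵥ v = v := by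
    intro v
    constructor
    · rintro ⟨w, rfl⟩
      rw [Matrix.toLin'_apply, Matrix.mulVec_mulVec, ← hmul, hφ.matrixUnit_mul_matrixUnit]
    · intro h
      exact ⟨v, h⟩
  -- The matrix units carry the base column of an intertwiner to all its other columns, so that
  -- column determines it.
  have hcol : ∀ T ∈ B.intertwiners (φ a) (φ b) (φ c), ∀ i,
      π (hφ.matrixUnit c i o) *ᵥ T.col o = T.col i := by
    intro T hT i
    have := congrArg (fun X => X.col o) (hT (hφ.matrixUnit c i o))
    simp only [hφ.map_matrixUnit_same] at this
    ext s
    have := congrFun this s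
    simpa [Matrix.mul_apply, Matrix.mulVec, dotProduct, Matrix.single_apply, Matrix.col] using this
  refine LinearEquiv.finrank_eq
    { toFun := fun T => ⟨T.1.col o, (hmem _).2 (hcol T.1 T.2 o)⟩
      map_add' := fun S T => rfl
      map_smul' := fun r T => rfl
      invFun := fun v => ⟨Matrix.of fun s i => (π (hφ.matrixUnit c i o) *ᵥ v.1) s, fun x => ?_⟩
      left_inv := fun T => ?_
      right_inv := fun v => ?_ }
  · ext s i
    have h1 : (π x * Matrix.of fun s i => (π (hφ.matrixUnit c i o) *ᵥ v.1) s) s i =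
        (π x *ᵥ (π (hφ.matrixUnit c i o) *ᵥ v.1)) s := rfl
    rw [← hπ, h1, Matrix.mulVec_mulVec, ← hmul, hφ.mul_matrixUnit]
    simp only [map_sum, map_smul, Matrix.sum_mulVec, Matrix.smul_mulVec, Finset.sum_apply,
      Pi.smul_apply, smul_eq_mul, Matrix.mul_apply, Matrix.of_apply]
    exact Finset.sum_congr rfl fun k _ => mul_comm _ _
  · ext s i
    exact congrFun (hcol T.1 T.2 i) s
  · ext s
    exact congrFun ((hmem v.1).1 v.2) s

/-- The trace of an idempotent is its rank, so the multiplicity is a value of the character. -/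
theorem fusionMult_eq_trace (a b c : ι) :
    (B.fusionMult φ a b c : ℂ) =
      (B.tensorRep (φ a) (φ b) (hφ.matrixUnit c (hφ.base c) (hφ.base c))).trace := by
  set P := B.tensorRep (φ a) (φ b) (hφ.matrixUnit c (hφ.base c) (hφ.base c)) with hP
  have hidem : IsIdempotentElem P.toLin' := by
    unfold IsIdempotentElem
    rw [Module.End.mul_eq_comp, ← Matrix.toLin'_mul, hP,
      ← (B.isStarMul_tensorRep φ a b).map_mul, hφ.matrixUnit_mul_matrixUnit]
  rw [B.fusionMult_eq_finrank hφ, ← LinearMap.IsProj.trace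
    (LinearMap.IsIdempotentElem.isProj_range _ hidem), Matrix.trace_toLin'_eq]

/-- The characters multiply according to the fusion multiplicities. -/
theorem trace_tensorRep_eq_sum (a b : ι) (x : A) :
    (B.tensorRep (φ a) (φ b) x).trace = ∑ c, (B.fusionMult φ a b c : ℂ) * (φ c x).trace := by
  have := hφ.tracial_eq_sum (Matrix.traceLinearMap _ ℂ ℂ ∘ₗ B.tensorRep (φ a) (φ b))
    (fun x y => by
      simp only [LinearMap.comp_apply, Matrix.traceLinearMap_apply,
        (B.isStarMul_tensorRep φ a b).map_mul]
      exact Matrix.trace_mul_comm _ _) x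
  simpa [B.fusionMult_eq_trace hφ] using this

theorem dualMul_irrChar (a b : ι) :
    B.dualMul (irrChar φ a) (irrChar φ b) =
      ∑ c, (B.fusionMult φ a b c : ℂ) • irrChar φ c := by
  ext x
  rw [← trace_tensorRep, B.trace_tensorRep_eq_sum hφ]
  simp

/-- Compare the coefficients of χ_d in (χ_a χ_b) χ_c = χ_a (χ_b χ_c); evaluation at a minimal
projection of block d extracts them. -/
theorem fusionMult_assoc (a b c d : ι) :
    ∑ e, B.fusionMult φ a b e * B.fusionMult φ e c d =
      ∑ f, B.fusionMult φ b c f * B.fusionMult φ a f d := by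
  have h := B.dualMul_assoc (irrChar φ a) (irrChar φ b) (irrChar φ c)
  simp only [B.dualMul_irrChar hφ, dualMul_sum_left, dualMul_sum_right] at h
  have h' := congrFun (congrArg DFunLike.coe h) (hφ.matrixUnit d (hφ.base d) (hφ.base d))
  have htr : ∀ e, (φ e (hφ.matrixUnit d (hφ.base d) (hφ.base d))).trace =
      if e = d then (1 : ℂ) else 0 := by
    intro e
    split_ifs with hed
    · subst hed
      simp [hφ.map_matrixUnit_same]
    · simp [hφ.map_matrixUnit_of_ne hed]
  simp only [LinearMap.sum_apply, LinearMap.smul_apply, irrChar_apply, htr, smul_eq_mul,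
    mul_ite, mul_one, mul_zero, Finset.sum_ite_eq', Finset.mem_univ, if_true] at h'
  exact_mod_cast h'

end CStarPreBialgebra

/-! ### Perron–Frobenius theory -/

section PerronFrobenius

variable {n : Type*} [Fintype n]

theorem Matrix.mulVec_pos_of_pos {R : Matrix n n ℝ} (hR : ∀ i j, 0 < R i j) {u : n → ℝ}
    (hu : ∀ i, 0 ≤ u i) (hu0 : u ≠ 0) (i : n) : 0 < (R *ᵥ u) i := by
  obtain ⟨k, hk⟩ := Function.ne_iff.mp hu0
  exact Finset.sum_pos' (fun j _ => mul_nonneg (hR i j).le (hu j))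
    ⟨k, Finset.mem_univ _, mul_pos (hR i k) (lt_of_le_of_ne (hu k) (Ne.symm hk))⟩

/-- **Perron's theorem**: a matrix with positive entries has a positive eigenvector. -/
theorem Matrix.exists_pos_eigenvector [Nonempty n] {R : Matrix n n ℝ} (hR : ∀ i j, 0 < R i j) :
    ∃ (r : ℝ) (v : n → ℝ), (∀ i, 0 < v i) ∧ R *ᵥ v = r • v := by
  -- Collatz–Wielandt: maximise t subject to t v ≤ R v on the simplex. The upper bound on t follows
  -- from the inequality and serves only compactness.
  let K : Set (ℝ × (n → ℝ)) :=
    (Set.Icc 0 (∑ i, ∑ j, R i j) ×ˢ stdSimplex ℝ n) ∩ {p | ∀ i, p.1 * p.2 i ≤ (R *ᵥ p.2) i}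
  have hK : IsCompact K := by
    refine (isCompact_Icc.prod (isCompact_stdSimplex ℝ n)).inter_right ?_
    simp only [Set.ofPred_forall]
    refine isClosed_iInter fun i => isClosed_le (by fun_prop) ?_
    simp only [Matrix.mulVec, dotProduct]
    fun_prop
  have hmemK : ∀ (t : ℝ) (v : n → ℝ), 0 ≤ t → v ∈ stdSimplex ℝ n →
      (∀ i, t * v i ≤ (R *ᵥ v) i) → (t, v) ∈ K := by
    intro t v ht hv h
    refine ⟨⟨⟨ht, ?_⟩, hv⟩, h⟩
    have hv1 : ∀ j, v j ≤ 1 := fun j => by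
      rw [← hv.2]
      exact Finset.single_le_sum (fun i _ => hv.1 i) (Finset.mem_univ j)
    calc t = ∑ i, t * v i := by rw [← Finset.mul_sum, hv.2, mul_one]
      _ ≤ ∑ i, (R *ᵥ v) i := Finset.sum_le_sum fun i _ => h i
      _ ≤ ∑ i, ∑ j, R i j := Finset.sum_le_sum fun i _ => Finset.sum_le_sum fun j _ =>
        mul_le_of_le_one_right (hR i j).le (hv1 j)
  have hne : K.Nonempty := by
    classical
    obtain ⟨i⟩ := ‹Nonempty n›
    refine ⟨(0, Pi.single i 1), hmemK _ _ le_rfl (single_mem_stdSimplex ℝ i) fun k => ?_⟩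
    rw [zero_mul]
    refine Finset.sum_nonneg fun j _ => mul_nonneg (hR k j).le ?_
    exact (single_mem_stdSimplex ℝ i).1 j
  obtain ⟨⟨t, v⟩, htv, hmax⟩ := hK.exists_isMaxOn hne continuous_fst.continuousOn
  have ht : 0 ≤ t := htv.1.1.1
  have hv : v ∈ stdSimplex ℝ n := htv.1.2
  have hle : ∀ i, t * v i ≤ (R *ᵥ v) i := htv.2
  have hv0 : v ≠ 0 := by
    rintro rfl
    simpa using hv.2
  have hw := Matrix.mulVec_pos_of_pos hR hv.1 hv0
  have heq : R *ᵥ v = t • v := by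
    by_contra hne
    -- If R v ≠ t v, then w = R v satisfies R w > t w in every coordinate, leaving room to raise t
    -- by `ε` against maximality.
    have hu := Matrix.mulVec_pos_of_pos hR (u := R *ᵥ v - t • v)
      (fun i => sub_nonneg.mpr (hle i)) (sub_ne_zero.mpr hne)
    set w := R *ᵥ v with hwdef
    have hRw : ∀ i, (R *ᵥ (w - t • v)) i = (R *ᵥ w) i - t * w i := fun i => by
      rw [Matrix.mulVec_sub, Matrix.mulVec_smul, Pi.sub_apply, Pi.smul_apply, smul_eq_mul]
    obtain ⟨i₀, hi₀⟩ := Finite.exists_min fun i => (R *ᵥ (w - t • v)) i / w i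
    set ε := (R *ᵥ (w - t • v)) i₀ / w i₀
    have hε : 0 < ε := div_pos (hu i₀) (hw i₀)
    have hs : 0 < ∑ i, w i := Finset.sum_pos (fun i _ => hw i) Finset.univ_nonempty
    have hmem : (t + ε, (∑ i, w i)⁻¹ • w) ∈ K := by
      refine hmemK _ _ (by positivity) ⟨fun i => ?_, ?_⟩ fun i => ?_
      · exact mul_nonneg (inv_nonneg.mpr hs.le) (hw i).le
      · simp only [Pi.smul_apply, smul_eq_mul, ← Finset.mul_sum]
        exact inv_mul_cancel₀ hs.ne'
      · have h1 : ε * w i ≤ (R *ᵥ w) i - t * w i := by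
          rw [← hRw]
          exact (le_div_iff₀ (hw i)).mp (hi₀ i)
        rw [Matrix.mulVec_smul, Pi.smul_apply, Pi.smul_apply, smul_eq_mul, smul_eq_mul,
          mul_left_comm]
        exact mul_le_mul_of_nonneg_left (by linarith) (inv_nonneg.mpr hs.le)
    have : t + ε ≤ t := hmax hmem
    linarith
  refine ⟨t, v, fun i => ?_, heq⟩
  have h := hw i
  rw [heq, Pi.smul_apply, smul_eq_mul] at h
  exact pos_of_mul_pos_right h ht

/-- The eigenspace of a positive eigenvector of a positive matrix is one-dimensional. -/
theorem Matrix.eq_smul_of_pos_eigenvector [Nonempty n] {R : Matrix n n ℝ}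
    (hR : ∀ i j, 0 < R i j) {r : ℝ} {v w : n → ℝ} (hv : ∀ i, 0 < v i) (hRv : R *ᵥ v = r • v)
    (hRw : R *ᵥ w = r • w) : ∃ c : ℝ, w = c • v := by
  -- The minimal ratio makes w - c v nonnegative with a zero at `i₀`. Were it nonzero, R would make
  -- it positive there, yet R only rescales it by r.
  obtain ⟨i₀, hi₀⟩ := Finite.exists_min fun i => w i / v i
  set c := w i₀ / v i₀ with hc
  refine ⟨c, sub_eq_zero.mp ?_⟩
  by_contra hne
  have hpos := Matrix.mulVec_pos_of_pos hR (u := w - c • v) (fun i => by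
    have := (le_div_iff₀ (hv i)).mp (hi₀ i)
    simpa using this) hne i₀
  have h0 : w i₀ - c * v i₀ = 0 := by
    rw [hc, div_mul_cancel₀ _ (hv i₀).ne', sub_self]
  rw [Matrix.mulVec_sub, Matrix.mulVec_smul, hRv, hRw, smul_comm, ← smul_sub, Pi.smul_apply,
    Pi.sub_apply, Pi.smul_apply, smul_eq_mul, smul_eq_mul, h0, mul_zero] at hpos
  exact lt_irrefl _ hpos

/-- The spectral radius of a nonnegative matrix with a positive eigenvector is the
corresponding eigenvalue. -/
theorem Matrix.spectralRadius_eq_of_pos_eigenvector [DecidableEq n] [Nonempty n]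
    {N : Matrix n n ℝ} (hN : ∀ i j, 0 ≤ N i j) {l : ℝ} {v : n → ℝ} (hv : ∀ i, 0 < v i)
    (hNv : N *ᵥ v = l • v) :
    (spectralRadius ℂ (N.map (fun x : ℝ => (x : ℂ)))).toReal = l := by
  have hl : 0 ≤ l := by
    obtain ⟨i⟩ := ‹Nonempty n›
    have h : 0 ≤ (N *ᵥ v) i := Finset.sum_nonneg fun j _ => mul_nonneg (hN i j) (hv j).le
    rw [hNv, Pi.smul_apply, smul_eq_mul] at h
    exact nonneg_of_mul_nonneg_left h (hv i)
  have hspec : ∀ μ : ℂ, μ ∈ spectrum ℂ (N.map (fun x : ℝ => (x : ℂ))) ↔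
      Module.End.HasEigenvalue (N.map (fun x : ℝ => (x : ℂ))).toLin' μ := fun μ => by
    rw [Module.End.hasEigenvalue_iff_mem_spectrum, Matrix.spectrum_toLin']
  have hmem : (l : ℂ) ∈ spectrum ℂ (N.map (fun x : ℝ => (x : ℂ))) := by
    rw [hspec]
    refine Module.End.hasEigenvalue_of_hasEigenvector (x := fun i => (v i : ℂ)) ⟨?_, ?_⟩
    · rw [Module.End.mem_eigenspace_iff, Matrix.toLin'_apply]
      ext i
      have := congrArg (fun x : ℝ => (x : ℂ)) (congrFun hNv i)
      simpa [Matrix.mulVec, dotProduct] using this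
    · intro h
      obtain ⟨i⟩ := ‹Nonempty n›
      exact (hv i).ne' (by simpa using congrFun h i)
  have hle : ∀ μ ∈ spectrum ℂ (N.map (fun x : ℝ => (x : ℂ))), ‖μ‖ ≤ l := by
    intro μ hμ
    rw [hspec] at hμ
    obtain ⟨w, hw⟩ := hμ.exists_hasEigenvector
    have hμw : ∀ i, μ * w i = ∑ j, (N i j : ℂ) * w j := fun i => by
      have := congrFun hw.apply_eq_smul i
      rw [Matrix.toLin'_apply] at this
      simpa [Matrix.mulVec, dotProduct] using this.symm
    -- In the sup norm weighted by `v`, the nonnegative matrix `N` has norm at most `l`; the bound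
    -- is read at the coordinate where the norm of `w` is attained.
    obtain ⟨i₀, hi₀⟩ := Finite.exists_max fun i => ‖w i‖ / v i
    set t := ‖w i₀‖ / v i₀ with ht
    have htw : ‖w i₀‖ = t * v i₀ := by rw [ht, div_mul_cancel₀ _ (hv i₀).ne']
    have ht0 : 0 < t := by
      by_contra hcon
      refine hw.2 (funext fun i => ?_)
      have h1 := (div_le_iff₀ (hv i)).mp ((hi₀ i).trans (not_lt.mp hcon))
      rw [zero_mul] at h1
      simpa using h1
    have h2 : ‖μ‖ * (t * v i₀) ≤ l * (t * v i₀) := by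
      calc ‖μ‖ * (t * v i₀) = ‖∑ j, (N i₀ j : ℂ) * w j‖ := by rw [← hμw, norm_mul, htw]
        _ ≤ ∑ j, N i₀ j * (t * v j) := by
          refine (norm_sum_le _ _).trans (Finset.sum_le_sum fun j _ => ?_)
          rw [norm_mul, Complex.norm_real, Real.norm_of_nonneg (hN i₀ j)]
          exact mul_le_mul_of_nonneg_left ((div_le_iff₀ (hv j)).mp (hi₀ j)) (hN i₀ j)
        _ = t * (N *ᵥ v) i₀ := by
          rw [Matrix.mulVec, dotProduct, Finset.mul_sum]
          exact Finset.sum_congr rfl fun j _ => by ring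
        _ = l * (t * v i₀) := by rw [hNv, Pi.smul_apply, smul_eq_mul]; ring
    exact le_of_mul_le_mul_right h2 (mul_pos ht0 (hv i₀))
  have : spectralRadius ℂ (N.map (fun x : ℝ => (x : ℂ))) = ENNReal.ofReal l := by
    refine le_antisymm (iSup₂_le fun μ hμ => ?_) ?_
    · rw [← ENNReal.ofReal_coe_nnreal, coe_nnnorm]
      exact ENNReal.ofReal_le_ofReal (hle μ hμ)
    · refine le_trans (le_of_eq ?_) (le_iSup₂ (f := fun k _ => (‖k‖₊ : ENNReal)) (l : ℂ) hmem)
      rw [← ENNReal.ofReal_coe_nnreal, coe_nnnorm, Complex.norm_real, Real.norm_of_nonneg hl]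
  rw [this, ENNReal.toReal_ofReal hl]

end PerronFrobenius

/-! ### Frobenius–Perron dimensions -/

namespace CStarPreBialgebra

variable {A : Type*} [Ring A] [Algebra ℂ A] [StarRing A] [StarModule ℂ A]
  [FiniteDimensional ℂ A] [IsSemisimpleRing A] (B : CStarPreBialgebra A)
  {ι : Type*} [Fintype ι] [DecidableEq ι] {D : ι → ℕ}
  {φ : ∀ a, A →⋆ₐ[ℂ] Matrix (Fin (D a)) (Fin (D a)) ℂ}

omit [FiniteDimensional ℂ A] [IsSemisimpleRing A] in
theorem fpDim_eq_of_pos_eigenvector [Nonempty ι] (a : ι) {l : ℝ} {v : ι → ℝ}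
    (hv : ∀ c, 0 < v c) (h : ∀ c, ∑ b, (B.fusionMult φ a b c : ℝ) * v b = l * v c) :
    B.fpDim φ a = l := by
  have := Matrix.spectralRadius_eq_of_pos_eigenvector
    (N := (B.fusionMatrix φ a).map (fun n : ℕ => (n : ℝ))) (fun _ _ => Nat.cast_nonneg _) hv
    (funext h)
  rw [← this, fpDim, Matrix.map_map]
  rfl

variable (hφ : IsIrrSystem D φ) (htrans : B.IsTransitive φ)
include hφ htrans

/-- By transitivity χ_b occurs in (χ_a χ_c) χ_a for some c. By associativity it occurs in χ_a (χ_c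
χ_a), hence in some χ_a χ_f. -/
theorem exists_fusionMult_pos (a b : ι) : ∃ c, 0 < B.fusionMult φ a c b := by
  obtain ⟨c, d, h1, h2⟩ := htrans a b
  by_contra! hcon
  have h := B.fusionMult_assoc hφ a c a b
  rw [Finset.sum_eq_zero (f := fun f => B.fusionMult φ c a f * B.fusionMult φ a f b)
    (fun f _ => by rw [Nat.le_zero.mp (hcon f), mul_zero]), Finset.sum_eq_zero_iff] at h
  exact (Nat.mul_pos h1 h2).ne' (h d (Finset.mem_univ _))

/-- The matrices `N_a` have a common positive eigenvector. -/
theorem exists_common_eigenvector : ∃ (l v : ι → ℝ), (∀ a, 0 < l a) ∧ (∀ c, 0 < v c) ∧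
    ∀ a c, ∑ b, (B.fusionMult φ a b c : ℝ) * v b = l a * v c := by
  rcases isEmpty_or_nonempty ι with hι | hι
  · exact ⟨0, 0, fun a => isEmptyElim a, fun a => isEmptyElim a, fun a => isEmptyElim a⟩
  -- Right multiplication by the sum of all characters; it commutes with the left multiplications `N
  -- a` by associativity.
  let R : Matrix ι ι ℝ := Matrix.of fun c a => ∑ b, (B.fusionMult φ a b c : ℝ)
  let N : ι → Matrix ι ι ℝ := fun a => Matrix.of fun c b => (B.fusionMult φ a b c : ℝ)
  have hR : ∀ c a, 0 < R c a := fun c a => by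
    obtain ⟨b, hb⟩ := B.exists_fusionMult_pos hφ htrans a c
    exact Finset.sum_pos' (fun _ _ => Nat.cast_nonneg _)
      ⟨b, Finset.mem_univ _, Nat.cast_pos.mpr hb⟩
  have hcomm : ∀ a, N a * R = R * N a := fun a => by
    ext c d
    simp only [Matrix.mul_apply, N, R, Matrix.of_apply, Finset.mul_sum, Finset.sum_mul]
    rw [Finset.sum_comm]
    conv_rhs => rw [Finset.sum_comm]
    refine Finset.sum_congr rfl fun f _ => ?_
    have := B.fusionMult_assoc hφ a d f c
    have h' : ∑ e, (B.fusionMult φ a d e : ℝ) * B.fusionMult φ e f c =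
      ∑ e, (B.fusionMult φ d f e : ℝ) * B.fusionMult φ a e c := by exact_mod_cast this
    simp only [mul_comm] at h' ⊢
    exact h'.symm
  obtain ⟨r, v, hv, hRv⟩ := Matrix.exists_pos_eigenvector hR
  -- `N a` preserves the eigenspace of `R` containing `v`, and that eigenspace is a line.
  have hex : ∀ a, ∃ c : ℝ, N a *ᵥ v = c • v := fun a => by
    refine Matrix.eq_smul_of_pos_eigenvector hR hv hRv ?_
    rw [Matrix.mulVec_mulVec, ← hcomm, ← Matrix.mulVec_mulVec, hRv, Matrix.mulVec_smul]
  choose l hl using hex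
  have hl' : ∀ a c, ∑ b, (B.fusionMult φ a b c : ℝ) * v b = l a * v c := fun a c =>
    congrFun (hl a) c
  refine ⟨l, v, fun a => ?_, hv, hl'⟩
  obtain ⟨b, hb⟩ := B.exists_fusionMult_pos hφ htrans a a
  have hpos : 0 < ∑ b, (B.fusionMult φ a b a : ℝ) * v b :=
    Finset.sum_pos' (fun j _ => mul_nonneg (Nat.cast_nonneg _) (hv j).le)
      ⟨b, Finset.mem_univ _, mul_pos (Nat.cast_pos.mpr hb) (hv b)⟩
  rw [hl'] at hpos
  exact pos_of_mul_pos_left hpos (hv a).le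

theorem fpDim_pos (a : ι) : 0 < B.fpDim φ a := by
  obtain ⟨l, v, hl, hv, h⟩ := B.exists_common_eigenvector hφ htrans
  have : Nonempty ι := ⟨a⟩
  rw [B.fpDim_eq_of_pos_eigenvector a hv (h a)]
  exact hl a

/-- The dimensions `d_a` form a character of the fusion ring. -/
theorem sum_fusionMult_mul_fpDim (a b : ι) :
    ∑ e, (B.fusionMult φ a b e : ℝ) * B.fpDim φ e = B.fpDim φ a * B.fpDim φ b := by
  obtain ⟨l, v, hl, hv, h⟩ := B.exists_common_eigenvector hφ htrans
  have : Nonempty ι := ⟨a⟩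
  simp only [fun a => B.fpDim_eq_of_pos_eigenvector a hv (h a)]
  -- Apply ∑_e N_{ab}^e N_e = N_a N_b to the common eigenvector and compare the coordinates at `a`.
  refine mul_right_cancel₀ (hv a).ne' ?_
  calc (∑ e, (B.fusionMult φ a b e : ℝ) * l e) * v a
      = ∑ e, (B.fusionMult φ a b e : ℝ) * ∑ c, (B.fusionMult φ e c a : ℝ) * v c := by
        rw [Finset.sum_mul]
        exact Finset.sum_congr rfl fun e _ => by rw [h, mul_assoc]
    _ = ∑ c, (∑ e, (B.fusionMult φ a b e : ℝ) * B.fusionMult φ e c a) * v c := by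
        simp only [Finset.mul_sum, Finset.sum_mul, ← mul_assoc]
        exact Finset.sum_comm
    _ = ∑ c, (∑ f, (B.fusionMult φ b c f : ℝ) * B.fusionMult φ a f a) * v c := by
        refine Finset.sum_congr rfl fun c _ => ?_
        have := B.fusionMult_assoc hφ a b c a
        rw [show ∑ e, (B.fusionMult φ a b e : ℝ) * B.fusionMult φ e c a =
          ∑ f, (B.fusionMult φ b c f : ℝ) * B.fusionMult φ a f a by exact_mod_cast this]
    _ = ∑ f, (B.fusionMult φ a f a : ℝ) * ∑ c, (B.fusionMult φ b c f : ℝ) * v c := by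
        simp only [Finset.mul_sum, Finset.sum_mul]
        rw [Finset.sum_comm]
        exact Finset.sum_congr rfl fun f _ => Finset.sum_congr rfl fun c _ => by ring
    _ = l b * ∑ f, (B.fusionMult φ a f a : ℝ) * v f := by
        rw [Finset.mul_sum]
        exact Finset.sum_congr rfl fun f _ => by rw [h]; ring
    _ = l a * l b * v a := by rw [h]; ring

variable (hdual : ∀ a : ι, ∃ a' : ι, B.fusionMatrix φ a' = (B.fusionMatrix φ a)ᵀ)
include hdual

/-- The vector of dimensions is a common eigenvector of the matrices `N_a`. -/
theorem sum_fusionMult_mul_fpDim' (a c : ι) :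
    ∑ b, (B.fusionMult φ a b c : ℝ) * B.fpDim φ b = B.fpDim φ a * B.fpDim φ c := by
  obtain ⟨a', ha'⟩ := hdual a
  have : Nonempty ι := ⟨a⟩
  have hpos := B.fpDim_pos hφ htrans
  have htr : ∀ b c, B.fusionMult φ a' c b = B.fusionMult φ a b c := fun b c =>
    congrFun (congrFun ha' b) c
  -- By the character property the vector of dimensions is a positive eigenvector of N_aᵀ = N_{a'}
  -- with eigenvalue d_a.
  have h1 : B.fpDim φ a' = B.fpDim φ a :=
    B.fpDim_eq_of_pos_eigenvector a' hpos fun c => by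
      simp only [htr]
      exact B.sum_fusionMult_mul_fpDim hφ htrans a c
  simp only [← htr]
  rw [B.sum_fusionMult_mul_fpDim hφ htrans, h1]

/-- Divided by the square of `totalFPDim`, this is the fixed point equation for the weights on which
the channels rest. -/
theorem sum_sum_fusionMult_mul_fpDim (c : ι) :
    ∑ a, ∑ b, (B.fusionMult φ a b c : ℝ) * (B.fpDim φ a * B.fpDim φ b) =
      B.totalFPDim φ * B.fpDim φ c := by
  rw [totalFPDim, Finset.sum_mul]
  refine Finset.sum_congr rfl fun a _ => ?_
  rw [pow_two, mul_assoc, ← B.sum_fusionMult_mul_fpDim' hφ htrans hdual, Finset.mul_sum]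
  exact Finset.sum_congr rfl fun b _ => by ring

end CStarPreBialgebra

/-! ### Completely positive maps and channels -/

section Channels

variable {m n : Type*} [Fintype m] [Fintype n]

/-- Complete positivity of a linear map between matrix algebras. -/
def IsCompletelyPositive (T : Matrix m m ℂ →ₗ[ℂ] Matrix n n ℂ) : Prop :=
  ∀ (k : ℕ) (X : Matrix (Fin k × m) (Fin k × m) ℂ), X.PosSemidef →
    (Matrix.of fun p q : Fin k × n =>
      T (Matrix.of fun i j => X (p.1, i) (q.1, j)) p.2 q.2).PosSemidef

/-- The map `X ↦ K X Kᴴ`. -/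
def krausMap (K : Matrix n m ℂ) : Matrix m m ℂ →ₗ[ℂ] Matrix n n ℂ where
  toFun X := K * X * Kᴴ
  map_add' X Y := by rw [Matrix.mul_add, Matrix.add_mul]
  map_smul' c X := by rw [Matrix.mul_smul, Matrix.smul_mul, RingHom.id_apply]

omit [Fintype n] in
theorem krausMap_apply (K : Matrix n m ℂ) (X : Matrix m m ℂ) : krausMap K X = K * X * Kᴴ := rfl

namespace IsCompletelyPositive

theorem kraus (K : Matrix n m ℂ) : IsCompletelyPositive (krausMap K) := by
  intro k X hX
  have h := hX.mul_mul_conjTranspose_same ((1 : Matrix (Fin k) (Fin k) ℂ) ⊗ₖ K)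
  convert h using 1
  ext p q
  simp only [Matrix.of_apply, krausMap_apply, Matrix.mul_apply, Matrix.conjTranspose_apply,
    Matrix.kroneckerMap_apply, Fintype.sum_prod_type, Matrix.one_apply, ite_mul, one_mul,
    zero_mul, apply_ite star, star_zero, mul_ite, mul_zero]
  simp only [Finset.sum_ite_irrel, Finset.sum_const_zero, Finset.sum_ite_eq, Finset.mem_univ,
    if_true]

omit [Fintype m] [Fintype n] in
theorem sum {κ : Type*} (s : Finset κ) {T : κ → Matrix m m ℂ →ₗ[ℂ] Matrix n n ℂ}
    (hT : ∀ k ∈ s, IsCompletelyPositive (T k)) : IsCompletelyPositive (∑ k ∈ s, T k) := by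
  intro k X hX
  convert Matrix.posSemidef_sum s fun i hi => hT i hi k X hX using 1
  ext p q
  simp [Matrix.sum_apply]

omit [Fintype m] [Fintype n] in
theorem add {S T : Matrix m m ℂ →ₗ[ℂ] Matrix n n ℂ} (hS : IsCompletelyPositive S)
    (hT : IsCompletelyPositive T) : IsCompletelyPositive (S + T) :=
  fun k X hX => (hS k X hX).add (hT k X hX)

omit [Fintype m] [Fintype n] in
theorem smul {T : Matrix m m ℂ →ₗ[ℂ] Matrix n n ℂ} (hT : IsCompletelyPositive T) {c : ℝ}
    (hc : 0 ≤ c) : IsCompletelyPositive ((c : ℂ) • T) :=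
  fun k X hX => (hT k X hX).smul (Complex.zero_le_real.mpr hc)

end IsCompletelyPositive

variable {m' n' : Type*} [Fintype m'] [Fintype n']

theorem IsQuantumChannel.reindex_comp {T : Matrix m m ℂ →ₗ[ℂ] Matrix n n ℂ}
    (hT : IsQuantumChannel T) (e : n ≃ n') :
    IsQuantumChannel ((Matrix.reindexLinearEquiv ℂ ℂ e e).toLinearMap ∘ₗ T) := by
  refine ⟨fun k X hX => (hT.1 k X hX).submatrix (Prod.map id e.symm), fun X => ?_⟩
  rw [← hT.2 X]
  exact Equiv.sum_comp e.symm fun i => T X i i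

theorem IsQuantumChannel.comp_reindex {T : Matrix m m ℂ →ₗ[ℂ] Matrix n n ℂ}
    (hT : IsQuantumChannel T) (e : m' ≃ m) :
    IsQuantumChannel (T ∘ₗ (Matrix.reindexLinearEquiv ℂ ℂ e e).toLinearMap) := by
  refine ⟨fun k X hX => hT.1 k _ (hX.submatrix (Prod.map id e.symm)), fun X => ?_⟩
  rw [LinearMap.comp_apply, hT.2]
  exact Equiv.sum_comp e.symm fun i => X i i

end Channels

/-! ### Block decompositions -/

section Blocks

variable {J : Type*} [DecidableEq J] {m : J → Type*} [∀ j, DecidableEq (m j)]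

/-- The isometric inclusion of the block `j`. -/
def blockInclusion (m : J → Type*) [∀ j, DecidableEq (m j)] (j : J) :
    Matrix (Σ j, m j) (m j) ℂ :=
  (1 : Matrix (Σ j, m j) (Σ j, m j) ℂ).submatrix id (Sigma.mk j)

theorem blockInclusion_conjTranspose_mul_mul [Fintype J] [∀ j, Fintype (m j)]
    (X : Matrix (Σ j, m j) (Σ j, m j) ℂ) (j : J) :
    (blockInclusion m j)ᴴ * X * blockInclusion m j = X.submatrix (Sigma.mk j) (Sigma.mk j) := by
  rw [blockInclusion, Matrix.conjTranspose_submatrix, Matrix.conjTranspose_one]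
  ext s t
  simp [Matrix.mul_apply, Matrix.one_apply]

theorem blockInclusion_mul_mul [∀ j, Fintype (m j)] (j : J) (Y : Matrix (m j) (m j) ℂ) :
    blockInclusion m j * Y * (blockInclusion m j)ᴴ =
      Matrix.blockDiagonal' (Pi.single j Y : ∀ j, Matrix (m j) (m j) ℂ) := by
  ext ⟨a, s⟩ ⟨b, t⟩
  rw [Matrix.blockDiagonal'_apply]
  by_cases ha : a = j
  · subst ha
    by_cases hb : b = a
    · subst hb
      simp [blockInclusion, Matrix.mul_apply, Matrix.one_apply]
    · simp [blockInclusion, Matrix.mul_apply, Matrix.one_apply, Ne.symm hb]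
  · by_cases hab : a = b
    · subst hab
      simp [blockInclusion, Matrix.mul_apply, Matrix.one_apply, ha]
    · simp [blockInclusion, Matrix.mul_apply, Matrix.one_apply, ha, hab]

omit [∀ j, DecidableEq (m j)] in
theorem blockDiagonal'_submatrix (Z : ∀ j, Matrix (m j) (m j) ℂ) (j : J) :
    (Matrix.blockDiagonal' Z).submatrix (Sigma.mk j) (Sigma.mk j) = Z j := by
  ext s t
  simp [Matrix.blockDiagonal'_apply]

omit [∀ j, DecidableEq (m j)] in
theorem sum_blockDiagonal'_single [Fintype J] (Z : ∀ j, Matrix (m j) (m j) ℂ) :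
    ∑ j, Matrix.blockDiagonal' (Pi.single j (Z j) : ∀ j, Matrix (m j) (m j) ℂ) =
      Matrix.blockDiagonal' Z := by
  rw [← Finset.univ_sum_single Z]
  simp only [← Matrix.blockDiagonal'AddMonoidHom_apply, map_sum]
  simp

omit [DecidableEq J] [∀ j, DecidableEq (m j)] in
theorem trace_eq_sum_submatrix [Fintype J] [∀ j, Fintype (m j)]
    (X : Matrix (Σ j, m j) (Σ j, m j) ℂ) :
    X.trace = ∑ j, (X.submatrix (Sigma.mk j) (Sigma.mk j)).trace := by
  simp [Matrix.trace, Fintype.sum_sigma]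

end Blocks

/-! ### Channels between weighted sums of representations -/

namespace IsIrrSystem

variable {A : Type*} [Ring A] [Algebra ℂ A] [StarRing A] [StarModule ℂ A]
  [IsSemisimpleRing A] {ι : Type*} [Fintype ι] [DecidableEq ι] {D : ι → ℕ}
  {φ : ∀ a, A →⋆ₐ[ℂ] Matrix (Fin (D a)) (Fin (D a)) ℂ} (hφ : IsIrrSystem D φ)
  [FiniteDimensional ℂ A] {m : Type*} [Fintype m] {π : A →ₗ[ℂ] Matrix m m ℂ}

/-- The Kraus operators of the embedding `M_{D c} → A → M_m` given by `π`. -/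
def embedKraus (π : A →ₗ[ℂ] Matrix m m ℂ) (c : ι) (p : m) : Matrix m (Fin (D c)) ℂ :=
  Matrix.of fun s i => π (hφ.matrixUnit c i (hφ.base c)) s p

/-- The factorisation e_{ij} = e_{io} (e_{jo})^*, with o the base index, puts the embedding of a
block in Kraus form. -/
theorem sum_embedKraus (hπ : IsStarMul π) (c : ι) (X : Matrix (Fin (D c)) (Fin (D c)) ℂ) :
    ∑ p, hφ.embedKraus π c p * X * (hφ.embedKraus π c p)ᴴ =
      ∑ i, ∑ j, X i j • π (hφ.matrixUnit c i j) := by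
  ext s t
  have h : ∀ i j, π (hφ.matrixUnit c i j) s t = ∑ p, π (hφ.matrixUnit c i (hφ.base c)) s p *
      star (π (hφ.matrixUnit c j (hφ.base c)) t p) := fun i j => by
    rw [← hφ.matrixUnit_mul_matrixUnit c i (hφ.base c) j, hπ.map_mul,
      ← hφ.star_matrixUnit c j (hφ.base c), hπ.map_star]
    rfl
  simp only [Matrix.sum_apply, Matrix.smul_apply, h, smul_eq_mul, Matrix.mul_apply, embedKraus,
    Matrix.of_apply, Matrix.conjTranspose_apply, Finset.mul_sum, Finset.sum_mul]
  rw [Finset.sum_comm]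
  conv_rhs => rw [Finset.sum_comm]
  refine Finset.sum_congr rfl fun j _ => ?_
  rw [Finset.sum_comm]
  exact Finset.sum_congr rfl fun i _ => Finset.sum_congr rfl fun p _ => by ring

/-- The adjoint Kraus operators give the adjoint of the embedding for the trace pairing. -/
theorem sum_embedKraus_conjTranspose (hπ : IsStarMul π) (c : ι) (Y : Matrix m m ℂ)
    (i j : Fin (D c)) :
    (∑ p, (hφ.embedKraus π c p)ᴴ * Y * hφ.embedKraus π c p) i j =
      (Y * π (hφ.matrixUnit c j i)).trace := by
  have h : ∀ s t, π (hφ.matrixUnit c j i) s t = ∑ p, π (hφ.matrixUnit c j (hφ.base c)) s p *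
      star (π (hφ.matrixUnit c i (hφ.base c)) t p) := fun s t => by
    rw [← hφ.matrixUnit_mul_matrixUnit c j (hφ.base c) i, hπ.map_mul,
      ← hφ.star_matrixUnit c i (hφ.base c), hπ.map_star]
    rfl
  simp only [Matrix.sum_apply, Matrix.trace, Matrix.diag, h, Matrix.mul_apply, embedKraus,
    Matrix.of_apply, Matrix.conjTranspose_apply, Finset.mul_sum, Finset.sum_mul]
  rw [Finset.sum_comm]
  conv_rhs => rw [Finset.sum_comm]
  refine Finset.sum_congr rfl fun t _ => ?_
  rw [Finset.sum_comm]
  exact Finset.sum_congr rfl fun s _ => Finset.sum_congr rfl fun p _ => by ring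

theorem sum_matrixUnit_diag : ∑ c, ∑ i, hφ.matrixUnit c i i = 1 := by
  conv_rhs => rw [hφ.eq_sum_matrixUnit 1]
  simp [Matrix.one_apply]

include hφ in
/-- If the `π j` decompose with multiplicities `N j c` and the weights `u`, `w` match, then
there are quantum channels between `⨁ w_c φ_c` and `⨁ u_j π_j`. -/
theorem exists_channels [Nonempty ι] {J : Type*} [Fintype J] [DecidableEq J] {m : J → Type*}
    [∀ j, Fintype (m j)] [∀ j, DecidableEq (m j)] {π : ∀ j, A →ₗ[ℂ] Matrix (m j) (m j) ℂ}
    (hπ : ∀ j, IsStarMul (π j)) (N : J → ι → ℕ)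
    (hN : ∀ j x, (π j x).trace = ∑ c, (N j c : ℂ) * (φ c x).trace)
    {w : ι → ℝ} (hw : ∀ c, 0 < w c) {u : J → ℝ} (hu : ∀ j, 0 ≤ u j)
    (huw : ∀ c, ∑ j, (N j c : ℝ) * u j = w c) :
    ∃ (T : Matrix (Σ c, Fin (D c)) (Σ c, Fin (D c)) ℂ →ₗ[ℂ] Matrix (Σ j, m j) (Σ j, m j) ℂ)
      (S : Matrix (Σ j, m j) (Σ j, m j) ℂ →ₗ[ℂ] Matrix (Σ c, Fin (D c)) (Σ c, Fin (D c)) ℂ),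
      IsQuantumChannel T ∧ IsQuantumChannel S ∧
      ∀ x : A, T (Matrix.blockDiagonal' fun c => (w c : ℂ) • φ c x) =
          Matrix.blockDiagonal' (fun j => (u j : ℂ) • π j x) ∧
        S (Matrix.blockDiagonal' fun j => (u j : ℂ) • π j x) =
          Matrix.blockDiagonal' fun c => (w c : ℂ) • φ c x := by
  let U : ∀ c, Matrix (Σ c, Fin (D c)) (Fin (D c)) ℂ := blockInclusion fun c => Fin (D c)
  let V : ∀ j, Matrix (Σ j, m j) (m j) ℂ := blockInclusion m
  let σ := Σ c, Fin (D c)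
  have huw' : ∀ c, ∑ j, (N j c : ℂ) * (u j : ℂ) = w c := fun c => by
    rw [← huw c]; push_cast; rfl
  have htr : ∀ j x c i k, (π j (x * hφ.matrixUnit c k i)).trace = (N j c : ℂ) * φ c x i k := by
    intro j x c i k
    rw [hN, Finset.sum_eq_single c]
    · rw [map_mul, hφ.map_matrixUnit_same, Matrix.trace_mul_comm]
      simp [Matrix.trace_single_mul]
    · intro b _ hb
      simp [hφ.map_matrixUnit_of_ne hb]
    · simp
  -- The trace on block c is multiplied by ∑_j N_{jc} u_j / w_c, which `huw` makes equal to 1.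
  let T : Matrix σ σ ℂ →ₗ[ℂ] Matrix (Σ j, m j) (Σ j, m j) ℂ :=
    ∑ j, ∑ c, ((u j / w c : ℝ) : ℂ) • ∑ p, krausMap (V j * hφ.embedKraus (π j) c p * (U c)ᴴ)
  let q : ∀ j, Matrix (m j) (m j) ℂ := fun j => 1 - π j 1
  -- The adjoint of the unweighted embedding loses the trace outside the projections `π j 1`. The
  -- second summand restores it by replacing that part with the maximally mixed state.
  let S : Matrix (Σ j, m j) (Σ j, m j) ℂ →ₗ[ℂ] Matrix σ σ ℂ :=
    ∑ j, (∑ c, ∑ p, krausMap (U c * (hφ.embedKraus (π j) c p)ᴴ * (V j)ᴴ) +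
      (((Fintype.card σ : ℝ)⁻¹ : ℝ) : ℂ) •
        ∑ s : σ, ∑ t : m j, krausMap (Matrix.single s t (1 : ℂ) * q j * (V j)ᴴ))
  have hT : ∀ X, T X = Matrix.blockDiagonal' fun j => ∑ c, ((u j / w c : ℝ) : ℂ) •
      ∑ i, ∑ k, X ⟨c, i⟩ ⟨c, k⟩ • π j (hφ.matrixUnit c i k) := by
    intro X
    rw [← sum_blockDiagonal'_single]
    simp only [T, LinearMap.sum_apply, LinearMap.smul_apply]
    refine Finset.sum_congr rfl fun j _ => ?_
    rw [← blockInclusion_mul_mul]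
    simp only [Matrix.mul_sum, Matrix.sum_mul, Matrix.mul_smul, Matrix.smul_mul]
    refine Finset.sum_congr rfl fun c _ => ?_
    have h := hφ.sum_embedKraus (hπ j) c
      (X.submatrix (Sigma.mk (β := fun c => Fin (D c)) c) (Sigma.mk (β := fun c => Fin (D c)) c))
    rw [← blockInclusion_conjTranspose_mul_mul] at h
    have h2 := congrArg (fun Z => V j * Z * (V j)ᴴ) h
    simp only [Matrix.mul_sum, Matrix.sum_mul, Matrix.mul_smul, Matrix.smul_mul] at h2
    congr 1
    simp only [blockInclusion_conjTranspose_mul_mul, Matrix.submatrix_apply] at h2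
    rw [← h2]
    refine Finset.sum_congr rfl fun p _ => ?_
    rw [krausMap_apply, ← blockInclusion_conjTranspose_mul_mul]
    simp only [Matrix.conjTranspose_mul, Matrix.conjTranspose_conjTranspose, Matrix.mul_assoc]
    rfl
  have hS : ∀ Y, S Y = Matrix.blockDiagonal' (fun c => Matrix.of fun i k =>
        ∑ j, (Y.submatrix (Sigma.mk j) (Sigma.mk j) * π j (hφ.matrixUnit c k i)).trace) +
      ((Fintype.card σ : ℂ)⁻¹ * ∑ j, (q j * Y.submatrix (Sigma.mk j) (Sigma.mk j) *
        (q j)ᴴ).trace) • (1 : Matrix σ σ ℂ) := by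
    intro Y
    simp only [S, LinearMap.sum_apply, LinearMap.add_apply, LinearMap.smul_apply,
      Finset.sum_add_distrib]
    congr 1
    · rw [← sum_blockDiagonal'_single, Finset.sum_comm]
      refine Finset.sum_congr rfl fun c _ => ?_
      rw [← blockInclusion_mul_mul]
      have h : (Matrix.of fun i k => ∑ j, (Y.submatrix (Sigma.mk j) (Sigma.mk j) *
          π j (hφ.matrixUnit c k i)).trace) = ∑ j, ∑ p, (hφ.embedKraus (π j) c p)ᴴ *
            Y.submatrix (Sigma.mk j) (Sigma.mk j) * hφ.embedKraus (π j) c p := by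
        ext i k
        rw [Matrix.sum_apply]
        simp only [hφ.sum_embedKraus_conjTranspose (hπ _), Matrix.of_apply]
      rw [h]
      simp only [Matrix.mul_sum, Matrix.sum_mul]
      refine Finset.sum_congr rfl fun j _ => Finset.sum_congr rfl fun p _ => ?_
      rw [krausMap_apply, ← blockInclusion_conjTranspose_mul_mul]
      simp only [Matrix.conjTranspose_mul, Matrix.conjTranspose_conjTranspose, Matrix.mul_assoc]
      rfl
    · rw [Finset.mul_sum, Finset.sum_smul]
      refine Finset.sum_congr rfl fun j _ => ?_
      rw [mul_smul]
      push_cast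
      congr 1
      have h : ∀ (s : σ) (t : m j), krausMap (Matrix.single s t (1 : ℂ) * q j * (V j)ᴴ) Y =
          (q j * Y.submatrix (Sigma.mk j) (Sigma.mk j) * (q j)ᴴ) t t • Matrix.single s s (1 : ℂ) := by
        intro s t
        rw [krausMap_apply, ← blockInclusion_conjTranspose_mul_mul]
        have : Matrix.single s t (1 : ℂ) * (q j * ((V j)ᴴ * Y * V j) * (q j)ᴴ) * Matrix.single t s (1 : ℂ) =
            (q j * ((V j)ᴴ * Y * V j) * (q j)ᴴ) t t • Matrix.single s s (1 : ℂ) := by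
          rw [Matrix.single_mul_mul_single]
          simp
        change _ = (q j * ((V j)ᴴ * Y * V j) * (q j)ᴴ) t t • _
        rw [← this]
        simp only [Matrix.conjTranspose_mul, Matrix.conjTranspose_conjTranspose, Matrix.mul_assoc,
          Matrix.conjTranspose_single, star_one]
      simp only [h, ← Finset.sum_smul]
      rw [← Finset.smul_sum]
      congr 1
      ext s t
      simp [Matrix.sum_apply, Matrix.single_apply, Matrix.one_apply, ite_and]
  refine ⟨T, S, ⟨?_, fun X => ?_⟩, ⟨?_, fun Y => ?_⟩, fun x => ⟨?_, ?_⟩⟩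
  · exact IsCompletelyPositive.sum _ fun j _ => IsCompletelyPositive.sum _ fun c _ =>
      (IsCompletelyPositive.sum _ fun p _ => IsCompletelyPositive.kraus _).smul
        (div_nonneg (hu j) (hw c).le)
  · rw [hT, Matrix.trace_blockDiagonal']
    have h1 : ∀ j c i k, (π j (hφ.matrixUnit c i k)).trace =
        (N j c : ℂ) * (1 : Matrix (Fin (D c)) (Fin (D c)) ℂ) k i := fun j c i k => by
      have := htr j 1 c k i
      rwa [one_mul, map_one] at this
    simp only [Matrix.trace_sum, Matrix.trace_smul, h1, smul_eq_mul]
    rw [Finset.sum_comm, trace_eq_sum_submatrix]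
    refine Finset.sum_congr rfl fun c _ => ?_
    have h2 : ∀ j, ∑ i, ∑ k, X ⟨c, i⟩ ⟨c, k⟩ *
        ((N j c : ℂ) * (1 : Matrix (Fin (D c)) (Fin (D c)) ℂ) k i) =
        N j c * (X.submatrix (Sigma.mk c) (Sigma.mk c)).trace := fun j => by
      simp [Matrix.one_apply, Matrix.trace, Finset.mul_sum, mul_comm]
    simp only [h2]
    have hwc : (w c : ℂ) ≠ 0 := by exact_mod_cast (hw c).ne'
    calc _ = (∑ j, (N j c : ℂ) * (u j : ℂ)) * ((w c : ℂ)⁻¹ *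
          (X.submatrix (Sigma.mk c) (Sigma.mk c)).trace) := by
          rw [Finset.sum_mul]
          refine Finset.sum_congr rfl fun j _ => ?_
          push_cast
          ring
      _ = _ := by rw [huw', ← mul_assoc, mul_inv_cancel₀ hwc, one_mul]
  · refine IsCompletelyPositive.sum _ fun j _ => IsCompletelyPositive.add ?_ ?_
    · exact IsCompletelyPositive.sum _ fun c _ => IsCompletelyPositive.sum _ fun p _ =>
        IsCompletelyPositive.kraus _
    · exact (IsCompletelyPositive.sum _ fun s _ => IsCompletelyPositive.sum _ fun t _ =>
        IsCompletelyPositive.kraus _).smul (by positivity)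
  · have hσ : (Fintype.card σ : ℂ) ≠ 0 := by
      obtain ⟨c⟩ := ‹Nonempty ι›
      have : Nonempty σ := ⟨⟨c, hφ.base c⟩⟩
      exact_mod_cast Fintype.card_ne_zero
    rw [hS, Matrix.trace_add, Matrix.trace_smul, Matrix.trace_one, smul_eq_mul, mul_right_comm,
      inv_mul_cancel₀ hσ, one_mul, Matrix.trace_blockDiagonal', trace_eq_sum_submatrix Y]
    have h1 : ∀ Z : ∀ j, Matrix (m j) (m j) ℂ, ∑ c, (Matrix.of fun i k =>
        ∑ j, (Z j * π j (hφ.matrixUnit c k i)).trace).trace = ∑ j, (Z j * π j 1).trace := by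
      intro Z
      simp only [← hφ.sum_matrixUnit_diag, map_sum, Matrix.mul_sum, Matrix.trace_sum]
      simp only [Matrix.trace, Matrix.diag, Matrix.of_apply]
      conv_rhs => rw [Finset.sum_comm]
      exact Finset.sum_congr rfl fun c _ => Finset.sum_comm
    rw [h1, ← Finset.sum_add_distrib]
    refine Finset.sum_congr rfl fun j _ => ?_
    have hqq : (q j)ᴴ * q j = q j := by
      have h11 : π j 1 * π j 1 = π j 1 := by rw [← (hπ j).map_mul, one_mul]
      have hst : (π j 1)ᴴ = π j 1 := by rw [← (hπ j).map_star, star_one]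
      simp [q, hst, mul_sub, sub_mul, h11]
    rw [Matrix.trace_mul_comm (q j * _), ← Matrix.mul_assoc, hqq, Matrix.trace_mul_comm (q j),
      ← Matrix.trace_add, ← Matrix.mul_add]
    simp [q]
  · rw [hT]
    congr 1
    ext1 j
    have hx := congrArg (π j) (hφ.eq_sum_matrixUnit x)
    simp only [map_sum, map_smul] at hx
    rw [hx]
    simp only [Matrix.blockDiagonal'_apply_eq, Finset.smul_sum]
    refine Finset.sum_congr rfl fun c _ => Finset.sum_congr rfl fun i _ =>
      Finset.sum_congr rfl fun k _ => ?_
    have hwc : (w c : ℂ) ≠ 0 := by exact_mod_cast (hw c).ne'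
    simp only [Matrix.smul_apply, smul_eq_mul, smul_smul]
    congr 1
    push_cast
    field_simp
  · rw [hS]
    simp only [blockDiagonal'_submatrix]
    -- The correction term of `S` vanishes on operators supported under `π j 1`.
    have h0 : ∀ j, q j * ((u j : ℂ) • π j x) = 0 := fun j => by
      simp only [q, Matrix.mul_smul, sub_mul, one_mul]
      rw [← (hπ j).map_mul, one_mul, sub_self]
    simp only [h0, Matrix.zero_mul, Matrix.trace_zero, Finset.sum_const_zero, mul_zero, zero_smul,
      add_zero]
    congr 1
    ext c i k
    simp only [Matrix.of_apply, Matrix.smul_mul, Matrix.trace_smul, ← (hπ _).map_mul, htr,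
      Matrix.smul_apply, smul_eq_mul]
    rw [← huw' c, Finset.sum_mul]
    exact Finset.sum_congr rfl fun j _ => by ring

end IsIrrSystem

/-! ### The fixed point tensor -/

namespace CStarPreBialgebra

section RepresentationTensor

variable {A : Type*} [Ring A] [Algebra ℂ A]
  {χ κ : Type*} [Fintype κ]

/-- The element `∑_I [ψ(e^I)]_{αβ} e_I` of `A`. -/
def bondElement (e : Module.Basis κ ℂ A) (ψ : Module.Dual ℂ A →ₗ[ℂ] Matrix χ χ ℂ) (α β : χ) : A :=
  ∑ I, ψ (e.coord I) α β • e I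

variable (e : Module.Basis κ ℂ A) (ψ : Module.Dual ℂ A →ₗ[ℂ] Matrix χ χ ℂ)

/-- Expand `f` in the dual basis. After this the choice of `e` no longer matters: bond matrices are
values of `ψ`. -/
theorem apply_bondElement (f : Module.Dual ℂ A) (α β : χ) :
    f (bondElement e ψ α β) = ψ f α β := by
  classical
  have h := congrArg (fun g => ψ g α β) (e.sum_dual_apply_smul_coord f)
  simp only [map_sum, map_smul, Matrix.sum_apply, Matrix.smul_apply, smul_eq_mul] at h
  rw [← h]
  simp [bondElement, mul_comm]

theorem apply_boundaryElement [Fintype χ] (f : Module.Dual ℂ A) :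
    f (boundaryElement e ψ) = (ψ f).trace := by
  classical
  have h := congrArg (fun g => (ψ g).trace) (e.sum_dual_apply_smul_coord f)
  simp only [map_sum, map_smul, Matrix.trace_sum, Matrix.trace_smul, smul_eq_mul] at h
  rw [← h]
  simp [boundaryElement, mul_comm]

end RepresentationTensor

variable {A : Type*} [Ring A] [Algebra ℂ A] [StarRing A] [StarModule ℂ A]
  {ι : Type*} [DecidableEq ι] {D : ι → ℕ}
  (φ : ∀ a, A →⋆ₐ[ℂ] Matrix (Fin (D a)) (Fin (D a)) ℂ)

/-- The direct sum `⨁ w_a φ_a`. -/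
def weightedSum (w : ι → ℂ) : A →ₗ[ℂ] Matrix (Σ a, Fin (D a)) (Σ a, Fin (D a)) ℂ where
  toFun x := Matrix.blockDiagonal' fun a => w a • φ a x
  map_add' x y := by
    rw [← Matrix.blockDiagonal'_add]
    congr 1
    ext1 a
    simp [smul_add]
  map_smul' c x := by
    rw [RingHom.id_apply, ← Matrix.blockDiagonal'_smul]
    congr 1
    ext1 a
    simp [smul_comm c]

omit [StarModule ℂ A] in
theorem weightedSum_apply (w : ι → ℂ) (x : A) :
    weightedSum φ w x = Matrix.blockDiagonal' fun a => w a • φ a x := rfl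

omit [StarModule ℂ A] in
theorem isStarMul_weightedSum_one [Fintype ι] : IsStarMul (weightedSum φ 1) where
  map_mul x y := by
    simp only [weightedSum_apply, Pi.one_apply, one_smul, map_mul]
    exact Matrix.blockDiagonal'_mul _ _
  map_star x := by
    simp only [weightedSum_apply, Pi.one_apply, one_smul, Matrix.blockDiagonal'_conjTranspose,
      map_star, Matrix.star_eq_conjTranspose]

omit [StarModule ℂ A] in
-- Entries between different blocks vanish, so the weight can be split symmetrically between row and
-- column, ready to become a conjugation.
theorem matrixEntry_weightedSum_mul_self (s : ι → ℂ) (i j : Σ a, Fin (D a)) :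
    matrixEntry (weightedSum φ fun a => s a * s a) i j =
      (s i.1 * s j.1) • matrixEntry (weightedSum φ 1) i j := by
  obtain ⟨a, i⟩ := i
  obtain ⟨b, j⟩ := j
  ext x
  by_cases h : a = b
  · subst h
    simp [weightedSum_apply]
  · simp [weightedSum_apply, Matrix.blockDiagonal'_apply_ne _ _ _ h]

/-- Two sites, each in a direct sum of blocks, are a direct sum over pairs of blocks. -/
def pairBlockEquiv (D : ι → ℕ) :
    (Σ ab : ι × ι, Fin (D ab.1) × Fin (D ab.2)) ≃ (Σ a, Fin (D a)) × (Σ a, Fin (D a)) where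
  toFun p := (⟨p.1.1, p.2.1⟩, ⟨p.1.2, p.2.2⟩)
  invFun p := ⟨(p.1.1, p.2.1), (p.1.2, p.2.2)⟩
  left_inv _ := rfl
  right_inv _ := rfl

omit [StarModule ℂ A] in
theorem kroneckerMap_weightedSum (w : ι → ℂ) (t : A ⊗[ℂ] A) :
    kroneckerMap (weightedSum φ w) (weightedSum φ w) t =
      Matrix.reindexLinearEquiv ℂ ℂ (pairBlockEquiv D) (pairBlockEquiv D)
        (Matrix.blockDiagonal' fun ab : ι × ι =>
          (w ab.1 * w ab.2) • kroneckerMap (irrLin φ ab.1) (irrLin φ ab.2) t) := by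
  ext ⟨⟨a, i⟩, ⟨b, k⟩⟩ ⟨⟨a', j⟩, ⟨b', l⟩⟩
  rw [Matrix.coe_reindexLinearEquiv, Matrix.reindex_apply, Matrix.submatrix_apply,
    show (pairBlockEquiv D).symm (⟨a, i⟩, ⟨b, k⟩) = ⟨(a, b), (i, k)⟩ from rfl,
    show (pairBlockEquiv D).symm (⟨a', j⟩, ⟨b', l⟩) = ⟨(a', b'), (j, l)⟩ from rfl]
  by_cases h : (a, b) = (a', b')
  · obtain ⟨rfl, rfl⟩ := Prod.mk.inj h
    rw [Matrix.blockDiagonal'_apply_eq]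
    induction t with
    | zero => simp
    | tmul x y => simp [weightedSum_apply]; ring
    | add t u ht hu => simp only [map_add, Matrix.add_apply, ht, hu, smul_add]
  · rw [Matrix.blockDiagonal'_apply_ne _ _ _ h]
    induction t with
    | zero => simp
    | tmul x y =>
      rw [kroneckerMap_tmul, Matrix.kroneckerMap_apply, weightedSum_apply, weightedSum_apply]
      by_cases ha : a = a'
      · have hb : b ≠ b' := fun hb => h (by rw [ha, hb])
        simp [Matrix.blockDiagonal'_apply, hb]
      · simp [Matrix.blockDiagonal'_apply, ha]
    | add t u ht hu => simp only [map_add, Matrix.add_apply, ht, hu, add_zero]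

variable [Fintype ι] {χ κ : Type*} [Fintype χ] [DecidableEq χ] [Fintype κ]
  (B : CStarPreBialgebra A) (e : Module.Basis κ ℂ A) (ψ : Module.Dual ℂ A →ₗ[ℂ] Matrix χ χ ℂ)

omit [Fintype χ] [DecidableEq χ] in
theorem fixedPointTensor_eq (α β : χ) : B.fixedPointTensor φ e ψ α β =
    weightedSum φ (fun a => ((B.fpDim φ a / B.totalFPDim φ : ℝ) : ℂ)) (bondElement e ψ α β) := by
  rw [fixedPointTensor, weightedSum_apply]
  congr 1
  ext1 a
  simp [repTensor, bondElement]

omit [Fintype χ] [DecidableEq χ] in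
theorem bondMatrix_fixedPointTensor (i j : Σ a, Fin (D a)) :
    MPOTensor.bondMatrix (B.fixedPointTensor φ e ψ) i j = ψ (matrixEntry (weightedSum φ
      (fun a => ((B.fpDim φ a / B.totalFPDim φ : ℝ) : ℂ))) i j) := by
  ext α β
  rw [← apply_bondElement e ψ, MPOTensor.bondMatrix, Matrix.of_apply, fixedPointTensor_eq]
  rfl

variable {ψ}

omit [DecidableEq χ] in
-- The bond contraction multiplies values of `ψ`, hence multiplies the matrix entries in the dual
-- algebra, where the product is the transposed coproduct.
theorem concat_fixedPointTensor (hψ : ∀ f g, ψ (B.dualMul f g) = ψ f * ψ g) (α β : χ) :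
    MPOTensor.concat (B.fixedPointTensor φ e ψ) α β =
      kroneckerMap (weightedSum φ (fun a => ((B.fpDim φ a / B.totalFPDim φ : ℝ) : ℂ)))
        (weightedSum φ (fun a => ((B.fpDim φ a / B.totalFPDim φ : ℝ) : ℂ)))
        (B.comul (bondElement e ψ α β)) := by
  ext ⟨i, k⟩ ⟨j, l⟩
  rw [kroneckerMap_apply, ← dualMul_apply, apply_bondElement, hψ, MPOTensor.concat,
    Matrix.sum_apply, Matrix.mul_apply]
  refine Finset.sum_congr rfl fun γ _ => ?_
  have h := B.bondMatrix_fixedPointTensor φ e ψ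
  exact congrArg₂ (· * ·) (congrFun (congrFun (h i j) α) γ) (congrFun (congrFun (h k l) γ) β)

/-- Products of bond matrices are given by a multiplicative `*`-map on the tensor power. -/
theorem exists_isStarMul_prod (hψ : ∀ f g, ψ (B.dualMul f g) = ψ f * ψ g) {σ : Type*} [Fintype σ]
    {F : A →ₗ[ℂ] Matrix σ σ ℂ} (hF : IsStarMul F) (N : ℕ) :
    ∃ G : A →ₗ[ℂ] Matrix (Fin (N + 1) → σ) (Fin (N + 1) → σ) ℂ, IsStarMul G ∧
      ∀ i j, (List.ofFn fun k => ψ (matrixEntry F (i k) (j k))).prod = ψ (matrixEntry G i j) := by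
  induction N with
  -- The induction starts at one site: without a counit the empty product need not lie in the range
  -- of `ψ`.
  | zero =>
    let E : (Fin 1 → σ) ≃ σ := Equiv.funUnique (Fin 1) σ
    refine ⟨(Matrix.reindexLinearEquiv ℂ ℂ E.symm E.symm).toLinearMap ∘ₗ F,
      ⟨fun x y => ?_, fun x => ?_⟩, fun i j => ?_⟩
    · simp only [LinearMap.comp_apply, hF.map_mul]
      exact (Matrix.submatrix_mul_equiv _ _ E E E).symm
    · simp only [LinearMap.comp_apply, hF.map_star]
      rfl
    · simp only [List.ofFn_succ, List.ofFn_zero, List.prod_cons, List.prod_nil, mul_one]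
      rfl
  | succ N ih =>
    obtain ⟨G, hG, hprod⟩ := ih
    let E : (Fin (N + 2) → σ) ≃ σ × (Fin (N + 1) → σ) := (Fin.consEquiv fun _ => σ).symm
    have hc := hF.conv hG B
    refine ⟨(Matrix.reindexLinearEquiv ℂ ℂ E.symm E.symm).toLinearMap ∘ₗ
      (kroneckerMap F G ∘ₗ B.comul), ⟨fun x y => ?_, fun x => ?_⟩, fun i j => ?_⟩
    · rw [LinearMap.comp_apply, hc.map_mul]
      exact (Matrix.submatrix_mul_equiv _ _ E E E).symm
    · rw [LinearMap.comp_apply, hc.map_star]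
      rfl
    · rw [List.ofFn_succ, List.prod_cons, hprod (fun k => i k.succ) fun k => j k.succ, ← hψ]
      congr 1
      ext x
      rw [dualMul_apply, ← kroneckerMap_apply]
      rfl

/-- The tensor generates an MPDO if the boundary element is positive. -/
theorem generatesMPDO_fixedPointTensor (hψ : ∀ f g, ψ (B.dualMul f g) = ψ f * ψ g)
    (hw : ∀ a, 0 ≤ B.fpDim φ a / B.totalFPDim φ) {y : A}
    (hy : boundaryElement e ψ = y * star y) : (B.fixedPointTensor φ e ψ).GeneratesMPDO := by
  intro N hN
  obtain ⟨N, rfl⟩ := Nat.exists_eq_add_of_le' hN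
  obtain ⟨G, hG, hprod⟩ := B.exists_isStarMul_prod hψ (isStarMul_weightedSum_one φ) N
  let s : ι → ℂ := fun a => (Real.sqrt (B.fpDim φ a / B.totalFPDim φ) : ℂ)
  have hs : (fun a => ((B.fpDim φ a / B.totalFPDim φ : ℝ) : ℂ)) = fun a => s a * s a := by
    ext1 a
    rw [← Complex.ofReal_mul, Real.mul_self_sqrt (hw a)]
  let Q : Matrix (Fin (N + 1) → Σ a, Fin (D a)) (Fin (N + 1) → Σ a, Fin (D a)) ℂ :=
    Matrix.diagonal fun i => ∏ k, s (i k).1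
  have hQ : Qᴴ = Q := by
    rw [Matrix.diagonal_conjTranspose]
    congr 1
    ext1 i
    simp [s]
  have hprodsmul : ∀ (M : ℕ) (c : Fin M → ℂ) (X : Fin M → Matrix χ χ ℂ),
      (List.ofFn fun k => c k • X k).prod = (∏ k, c k) • (List.ofFn X).prod := by
    intro M
    induction M with
    | zero => intro c X; simp
    | succ M ih =>
      intro c X
      rw [List.ofFn_succ, List.ofFn_succ, List.prod_cons, List.prod_cons,
        ih (fun k => c k.succ), Fin.prod_univ_succ, smul_mul_smul_comm]
  -- Pulling out the weights leaves the entry of `G` at the boundary element, which factors as `G y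
  -- * (G y)ᴴ`.
  have h : MPOTensor.mpo (B.fixedPointTensor φ e ψ) (N + 1) = Q * (G y * (G y)ᴴ) * Qᴴ := by
    rw [hQ, ← hG.map_star, ← hG.map_mul, ← hy]
    ext i j
    rw [Matrix.mul_diagonal, Matrix.diagonal_mul, MPOTensor.mpo, Matrix.of_apply]
    simp only [bondMatrix_fixedPointTensor, hs, matrixEntry_weightedSum_mul_self, map_smul]
    rw [hprodsmul, hprod, Matrix.trace_smul, ← apply_boundaryElement e ψ, matrixEntry_apply,
      Finset.prod_mul_distrib, smul_eq_mul]
    ring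
  rw [h]
  exact (Matrix.posSemidef_self_mul_conjTranspose _).mul_mul_conjTranspose_same Q

variable {φ} [FiniteDimensional ℂ A] [IsSemisimpleRing A]

omit [DecidableEq χ] in
theorem rfpConditions_fixedPointTensor (hφ : IsIrrSystem D φ) (htrans : B.IsTransitive φ)
    (hdual : ∀ a : ι, ∃ a' : ι, B.fusionMatrix φ a' = (B.fusionMatrix φ a)ᵀ)
    (hψ : ∀ f g, ψ (B.dualMul f g) = ψ f * ψ g) : (B.fixedPointTensor φ e ψ).RFPConditions := by
  -- Without irreducible representations the physical space is zero and zero maps are channels. The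
  -- general construction needs a nonzero space for its maximally mixed state.
  rcases isEmpty_or_nonempty ι with hι | hι
  · exact ⟨0, 0, ⟨fun k X _ => by
        convert Matrix.PosSemidef.zero using 1; ext p; exact isEmptyElim p.2.1.1,
      fun X => by simp [Matrix.trace]⟩, ⟨fun k X _ => by
        convert Matrix.PosSemidef.zero using 1; ext p; exact isEmptyElim p.2.1,
      fun X => by simp [Matrix.trace]⟩,
      fun α β => ⟨by ext p; exact isEmptyElim p.1.1, by ext p; exact isEmptyElim p.1⟩⟩
  have hd := B.fpDim_pos hφ htrans
  have hFP : 0 < B.totalFPDim φ :=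
    Finset.sum_pos (fun a _ => pow_pos (hd a) 2) Finset.univ_nonempty
  let w : ι → ℝ := fun a => B.fpDim φ a / B.totalFPDim φ
  have hw : ∀ a, 0 < w a := fun a => div_pos (hd a) hFP
  obtain ⟨T, S, hT, hS, h⟩ := hφ.exists_channels (J := ι × ι)
    (m := fun ab => Fin (D ab.1) × Fin (D ab.2))
    (π := fun ab => B.tensorRep (φ ab.1) (φ ab.2))
    (fun ab => B.isStarMul_tensorRep φ ab.1 ab.2)
    (fun ab c => B.fusionMult φ ab.1 ab.2 c)
    (fun ab x => B.trace_tensorRep_eq_sum hφ ab.1 ab.2 x)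
    (w := w) hw (u := fun ab => w ab.1 * w ab.2)
    (fun ab => (mul_pos (hw _) (hw _)).le) (fun c => by
      rw [Fintype.sum_prod_type]
      have h := B.sum_sum_fusionMult_mul_fpDim hφ htrans hdual c
      simp only [w]
      rw [eq_div_iff hFP.ne', ← mul_right_inj' hFP.ne', ← h, Finset.sum_mul, Finset.mul_sum]
      refine Finset.sum_congr rfl fun a _ => ?_
      rw [Finset.sum_mul, Finset.mul_sum]
      refine Finset.sum_congr rfl fun b _ => ?_
      field_simp)
  have hcat : ∀ x, Matrix.reindexLinearEquiv ℂ ℂ (pairBlockEquiv D) (pairBlockEquiv D)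
      (Matrix.blockDiagonal' fun ab : ι × ι =>
        ((w ab.1 * w ab.2 : ℝ) : ℂ) • B.tensorRep (φ ab.1) (φ ab.2) x) =
      kroneckerMap (weightedSum φ fun a => (w a : ℂ)) (weightedSum φ fun a => (w a : ℂ))
        (B.comul x) := by
    intro x
    rw [kroneckerMap_weightedSum]
    simp only [Complex.ofReal_mul]
    rfl
  refine ⟨_, _, hT.reindex_comp (pairBlockEquiv D), hS.comp_reindex (pairBlockEquiv D).symm,
    fun α β => ?_⟩
  rw [concat_fixedPointTensor φ B e hψ, fixedPointTensor_eq]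
  change _ = kroneckerMap (weightedSum φ fun a => (w a : ℂ)) (weightedSum φ fun a => (w a : ℂ)) _
    ∧ (S ∘ₗ _) (kroneckerMap (weightedSum φ fun a => (w a : ℂ))
      (weightedSum φ fun a => (w a : ℂ)) _) = _
  rw [← hcat]
  refine ⟨congrArg (Matrix.reindexLinearEquiv ℂ ℂ (pairBlockEquiv D) (pairBlockEquiv D)) (h _).1,
     Eq.trans (congrArg S ?_) (h (bondElement e ψ α β)).2⟩
  exact (Matrix.reindexLinearEquiv ℂ ℂ (pairBlockEquiv D) (pairBlockEquiv D)).symm_apply_apply _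

end CStarPreBialgebra

end

theorem mainTheorem1
    {A : Type*} [Ring A] [Algebra ℂ A] [StarRing A] [StarModule ℂ A]
    [FiniteDimensional ℂ A] [IsSemisimpleRing A]
    (B : CStarPreBialgebra A)
    {ι : Type*} [Fintype ι] [DecidableEq ι] (D : ι → ℕ)
    (φ : ∀ a, A →⋆ₐ[ℂ] Matrix (Fin (D a)) (Fin (D a)) ℂ)
    (hφ : IsIrrSystem D φ)
    (htrans : B.IsTransitive φ)
    (hdual : ∀ a : ι, ∃ a' : ι, B.fusionMatrix φ a' = (B.fusionMatrix φ a)ᵀ)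
    {χ : Type*} [Fintype χ] [DecidableEq χ]
    (ψ : Module.Dual ℂ A →ₗ[ℂ] Matrix χ χ ℂ) (hψ : B.IsFaithfulDualRep ψ)
    {κ : Type*} [Fintype κ] (e : Module.Basis κ ℂ A) :
    (B.fixedPointTensor φ e ψ).RFPConditions ∧
      ((∃ y : A, CStarPreBialgebra.boundaryElement e ψ = y * star y) →
        (B.fixedPointTensor φ e ψ).GeneratesMPDO) := by
  refine ⟨B.rfpConditions_fixedPointTensor e hφ htrans hdual hψ.1, fun ⟨y, hy⟩ => ?_⟩
  exact B.generatesMPDO_fixedPointTensor φ e hψ.1 (fun a => div_nonneg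
    (B.fpDim_pos hφ htrans a).le (Finset.sum_nonneg fun b _ => sq_nonneg _)) hy
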